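/- Let $\mathcal H$ be a complex Hilbert space and $\mathcal V,\mathcal W\subset\mathcal H$ finite dimensional subspaces with $\mathcal V\oplus\mathcal W^\perp=\mathcal H$ (algebraic direct sum), $d=\dim\mathcal W=\dim\mathcal V$. Let $\mathcal F=\{f_i\}_{i=1}^n$ be a frame for $\mathcal W$ (so $f_i\in\mathcal W$), with $n\ge 2d$. Notation. For a finite family $\mathcal G=\{g_i\}_{i=1}^n$ in $\mathcal H$ let $S_{\mathcal G}=\sum_i\langle\,\cdot\,,g_i\rangle g_i$ be its frame operator and let $\lambda_1(S_{\mathcal G})\ge\dots\ge\lambda_r(S_{\mathcal G})>0$ be the eigenvalues, with multiplicity, of $S_{\mathcal G}$ on its range $\mathrm{span}\{g_i\}$, $r=\dim\mathrm{span}\{g_i\}$; thus $\operatorname{tr}S_{\mathcal G}=\sum_{i\le r}\lambda_i(S_{\mathcal G})$. For convex $h:[0,\infty)\to[0,\infty)$ put $P_h(\mathcal G)=\sum_{i\le r}h(\lambda_i(S_{\mathcal G}))$. For a unitary $U$ on $\mathcal H$ put $U\cdot\mathcal F=\{Uf_i\}$. For a frame $\mathcal E=\{e_i\}_{i=1}^n$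 for $\mathcal W$: the canonical $\mathcal V$-dual is $\mathcal E^\#_{\mathcal V}=\{P_{\mathcal V//\mathcal W^\perp}S_{\mathcal E}^\dagger e_i\}$, where $P_{\mathcal V//\mathcal W^\perp}$ is the projection with range $\mathcal V$ and kernel $\mathcal W^\perp$ and $\dagger$ is the Moore–Penrose pseudo-inverse; $\mathcal D_{\mathcal V}(\mathcal E)$ is the set of $\mathcal G=\{g_i\}_{i=1}^n$ in $\mathcal V$ with $g=\sum_i\langle g,e_i\rangle g_i$ for all $g\in\mathcal V$; $\mathcal D_{\mathcal V,t}(\mathcal E)=\{\mathcal G\in\mathcal D_{\mathcal V}(\mathcal E):\sum_i\|g_i\|^2\ge t\}$; and an optimal dual in $\mathcal D_{\mathcal V,t}(\mathcal E)$ is an element that minimizes $P_h$ over $\mathcal D_{\mathcal V,t}(\mathcal E)$ simultaneously for all non-decreasing convex $h:[0,\infty)\to[0,\infty)$. Let $0\le\theta_1\le\dots\le\theta_d\le\pi/2$ be the principal angles between $\mathcal V$ and $\mathcal W$, i.e. $\cos\theta_1\ge\dots\ge\cos\theta_d$ are the eigenvalues, with multiplicity, of $|P_{\mathcal W}P_{\mathcal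 V}|$ on $\mathcal V$, where $P_{\mathcal V},P_{\mathcal W}$ are the orthogonal projections onto $\mathcal V,\mathcal W$. Let $w_1,\dots,w_d$ be principal vectors in $\mathcal W$, i.e. an orthonormal basis of $\mathcal W$ with $|P_{\mathcal V}P_{\mathcal W}|w_j=\cos(\theta_j)w_j$. Let $x_1,\dots,x_d$ be an orthonormal basis of $\mathcal W$ with $S_{\mathcal F}x_j=\lambda_j(S_{\mathcal F})x_j$ for all $j$, and let $U_0$ be a unitary operator on $\mathcal H$ with $U_0x_j=w_{d-j+1}$ for all $j$. Then for every unitary $U$ on $\mathcal H$ with $U(\mathcal W)=\mathcal W$: 1. $\operatorname{tr}S_{(U_0\cdot\mathcal F)^\#_{\mathcal V}}\le\operatorname{tr}S_{(U\cdot\mathcal F)^\#_{\mathcal V}}$. 2. Let $t\ge\operatorname{tr}S_{(U\cdot\mathcal F)^\#_{\mathcal V}}$. If $d\ge1$, then optimal duals exist in $\mathcal D_{\mathcal V,t}(U_0\cdot\mathcal F)$ and in $\mathcal D_{\mathcal V,t}(U\cdot\mathcal F)$. Whenever $\mathcal G^{op}_t(U_0)$ and $\mathcal G^{op}_t(U)$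 are optimal duals in these two sets, $P_h(\mathcal G^{op}_t(U_0))\le P_h(\mathcal G^{op}_t(U))$ for every convex $h:[0,\infty)\to[0,\infty)$, monotone or not. -/

import Mathlib

noncomputable section

namespace ObliqueDual

open scoped BigOperators

variable {H : Type*} [NormedAddCommGroup H] [InnerProductSpace ℂ H]

/-- A finite family `F` is a frame for `W`: it lies in `W` and satisfies the two frame
inequalities on `W`. -/
def IsFrameFor {n : ℕ} (W : Submodule ℂ H) (F : Fin n → H) : Prop :=
  (∀ i, F i ∈ W) ∧ ∃ A B : ℝ, 0 < A ∧ A < B ∧ ∀ f ∈ W,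
    A * ‖f‖ ^ 2 ≤ ∑ i, ‖inner ℂ (F i) f‖ ^ 2 ∧ ∑ i, ‖inner ℂ (F i) f‖ ^ 2 ≤ B * ‖f‖ ^ 2

/-- The frame operator `S_F = ∑ i, f_i ⊗ f_i`, that is `S_F x = ∑ i, ⟨x, f_i⟩ f_i`. (Mathlib's
inner product is conjugate-linear in the first argument.) -/
def frameOp {n : ℕ} (F : Fin n → H) : H →L[ℂ] H :=
  ∑ i, InnerProductSpace.rankOne ℂ (F i) (F i)

/-- The rotated family `U · F`. -/
def rotate {n : ℕ} (U : H ≃ₗᵢ[ℂ] H) (F : Fin n → H) : Fin n → H := fun i => U (F i)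

/-- `span F`, the range of the frame operator of a finite family. -/
abbrev spanOf {n : ℕ} (F : Fin n → H) : Submodule ℂ H := Submodule.span ℂ (Set.range F)

instance {n : ℕ} (F : Fin n → H) : FiniteDimensional ℂ (spanOf F) :=
  FiniteDimensional.span_of_finite ℂ (Set.finite_range F)

theorem frameOp_apply {n : ℕ} (F : Fin n → H) (x : H) :
    frameOp F x = ∑ i, inner ℂ (F i) x • F i := by
  simp [frameOp]

theorem finiteDimensional_range_frameOp {n : ℕ} (F : Fin n → H) :
    FiniteDimensional ℂ (LinearMap.range (frameOp F).toLinearMap) := by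
  refine Submodule.finiteDimensional_of_le (S₂ := spanOf F) ?_
  rintro _ ⟨x, rfl⟩
  rw [ContinuousLinearMap.coe_coe, frameOp_apply]
  exact Submodule.sum_mem _ fun i _ =>
    Submodule.smul_mem _ _ (Submodule.subset_span ⟨i, rfl⟩)

/-- The compression `P_M T|_M` of an operator to a subspace `M`. -/
def compression (T : H →L[ℂ] H) (M : Submodule ℂ H) [FiniteDimensional ℂ M] : M →ₗ[ℂ] M :=
  M.orthogonalProjectionOnto.toLinearMap ∘ₗ T.toLinearMap ∘ₗ M.subtype

/-- The class of convex functions `[0, ∞) → [0, ∞)`; such an `h` is represented by a function on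
`ℝ` of which only the values on `[0, ∞)` matter. -/
def IsConv (h : ℝ → ℝ) : Prop :=
  ConvexOn ℝ (Set.Ici 0) h ∧ ∀ x, 0 ≤ x → 0 ≤ h x

/-- Oblique `V`-duals of `F`: families `G` in `V` with `g = ∑ i, ⟨g, f_i⟩ g_i` for all
`g ∈ V`. -/
def obliqueDuals {n : ℕ} (V : Submodule ℂ H) (F : Fin n → H) : Set (Fin n → H) :=
  {G | (∀ i, G i ∈ V) ∧ ∀ g ∈ V, g = ∑ i, inner ℂ (F i) g • G i}

/-- Oblique `V`-duals with the restriction `∑ i, ‖g_i‖² ≥ t`. -/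
def obliqueDualsTr {n : ℕ} (V : Submodule ℂ H) (F : Fin n → H) (t : ℝ) : Set (Fin n → H) :=
  {G | G ∈ obliqueDuals V F ∧ t ≤ ∑ i, ‖G i‖ ^ 2}

variable [CompleteSpace H]

/-- The four Penrose equations: `B` is the Moore-Penrose pseudo-inverse of `A`. -/
def IsMoorePenrose (A B : H →L[ℂ] H) : Prop :=
  A * B * A = A ∧ B * A * B = B ∧ IsSelfAdjoint (A * B) ∧ IsSelfAdjoint (B * A)

theorem exists_isMoorePenrose (A : H →L[ℂ] H)
    (hA : FiniteDimensional ℂ (LinearMap.range A.toLinearMap)) :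
    ∃ B : H →L[ℂ] H, IsMoorePenrose A B := by
  set K : Submodule ℂ H := LinearMap.ker A.toLinearMap with hK
  set R : Submodule ℂ H := LinearMap.range A.toLinearMap with hR
  have hclosed : IsClosed (K : Set H) := A.isClosed_ker
  have hcs : CompleteSpace K := hclosed.completeSpace_coe
  have hc : IsCompl K Kᗮ := K.isCompl_orthogonal
  let e : R ≃ₗ[ℂ] Kᗮ :=
    (LinearMap.quotKerEquivRange A.toLinearMap).symm ≪≫ₗ
      Submodule.quotientEquivOfIsCompl K Kᗮ hc
  let g : R →L[ℂ] H := LinearMap.toContinuousLinearMap (Kᗮ.subtype ∘ₗ e.toLinearMap)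
  let B : H →L[ℂ] H := g ∘L R.orthogonalProjectionOnto
  have hAe : ∀ r : R, A (e r : H) = r := by
    intro r
    obtain ⟨q, rfl⟩ := (LinearMap.quotKerEquivRange A.toLinearMap).surjective r
    obtain ⟨x, rfl⟩ := (Submodule.quotientEquivOfIsCompl K Kᗮ hc).symm.surjective q
    simp [e]
  have heA : ∀ x : Kᗮ, ∀ r : R, (r : H) = A x → e r = x := by
    intro x r hr
    have h1 : A ((e r : H) - x) = 0 := by rw [map_sub, hAe, hr, sub_self]
    have h2 : (e r : H) - x ∈ K := by simpa [hK] using h1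
    have h3 : (e r : H) - x ∈ Kᗮ := Submodule.sub_mem _ (e r).2 x.2
    have h4 : (e r : H) - x = 0 := by
      have := hc.disjoint.le_bot ⟨h2, h3⟩
      simpa using this
    exact Subtype.ext (sub_eq_zero.mp h4)
  have hB : ∀ y, B y = (e (R.orthogonalProjectionOnto y) : H) := fun y => rfl
  have hAB : A * B = R.starProjection := by
    ext y
    rw [mul_apply_eq_comp, hB, hAe]
    rfl
  have hBA : B * A = Kᗮ.starProjection := by
    ext y
    rw [mul_apply_eq_comp, hB]
    have hy : A y = A (Kᗮ.starProjection y) := by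
      have h1 : y - Kᗮ.starProjection y ∈ Kᗮᗮ := Submodule.sub_starProjection_mem_orthogonal y
      rw [Submodule.orthogonal_orthogonal] at h1
      have h2 : A (y - Kᗮ.starProjection y) = 0 := LinearMap.mem_ker.mp h1
      rw [map_sub] at h2
      exact sub_eq_zero.mp h2
    have hmem : A y ∈ R := ⟨y, rfl⟩
    have := heA (Kᗮ.orthogonalProjectionOnto y) (R.orthogonalProjectionOnto (A y)) (by
      have h5 : (R.orthogonalProjectionOnto (A y) : H) = A y :=
        Submodule.starProjection_eq_self_iff.mpr hmem
      rw [h5, hy]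
      rfl)
    rw [this]
    rfl
  refine ⟨B, ?_, ?_, ?_, ?_⟩
  · ext y
    rw [hAB, mul_apply_eq_comp]
    exact Submodule.starProjection_eq_self_iff.mpr ⟨y, rfl⟩
  · ext y
    rw [hBA, mul_apply_eq_comp]
    exact Submodule.starProjection_eq_self_iff.mpr (e _).2
  · rw [hAB]; exact isSelfAdjoint_starProjection R
  · rw [hBA]; exact isSelfAdjoint_starProjection Kᗮ

/-- The Moore-Penrose pseudo-inverse `S_F†` of the frame operator. -/
def frameOpPinv {n : ℕ} (F : Fin n → H) : H →L[ℂ] H :=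
  Classical.choose (exists_isMoorePenrose (frameOp F) (finiteDimensional_range_frameOp F))

theorem frameOpPinv_spec {n : ℕ} (F : Fin n → H) :
    IsMoorePenrose (frameOp F) (frameOpPinv F) :=
  Classical.choose_spec
    (exists_isMoorePenrose (frameOp F) (finiteDimensional_range_frameOp F))

/-- The canonical `V`-dual `P_{V//Wᗮ} S_F† f_i`, where `P_{V//Wᗮ}` is the oblique projection with
range `V` and kernel `Wᗮ`. -/
def canonicalDual {n : ℕ} (V W : Submodule ℂ H) (hVW : IsCompl V Wᗮ) (F : Fin n → H) :
    Fin n → H :=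
  fun i => V.projection Wᗮ hVW (frameOpPinv F (F i))

theorem compression_isSymmetric {T : H →L[ℂ] H} (hT : IsSelfAdjoint T) (M : Submodule ℂ H)
    [FiniteDimensional ℂ M] : (compression T M).IsSymmetric := by
  have hs := ContinuousLinearMap.isSelfAdjoint_iff_isSymmetric.mp hT
  intro x y
  change inner ℂ (M.orthogonalProjectionOnto (T x)) y
    = inner ℂ x (M.orthogonalProjectionOnto (T y))
  rw [Submodule.coe_inner, Submodule.coe_inner]
  have h1 := M.inner_starProjection_left_eq_right (T x) (y : H)
  have h2 := M.inner_starProjection_left_eq_right (x : H) (T y)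
  rw [Submodule.starProjection_eq_self_iff.mpr y.2] at h1
  rw [Submodule.starProjection_eq_self_iff.mpr x.2] at h2
  exact h1.trans ((hs _ _).trans h2)

/-- The eigenvalues of the compression of the self-adjoint operator `T` to `M`, counted with
multiplicity, in non-increasing order and padded by zeros (the indices start at `0`). -/
def eigList (T : H →L[ℂ] H) (hT : IsSelfAdjoint T) (M : Submodule ℂ H) [FiniteDimensional ℂ M]
    (k : ℕ) : ℝ :=
  if hk : k < Module.finrank ℂ M then
    (compression_isSymmetric hT M).eigenvalues rfl ⟨k, hk⟩
  else 0

theorem frameOp_isSelfAdjoint {n : ℕ} (F : Fin n → H) : IsSelfAdjoint (frameOp F) := by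
  rw [ContinuousLinearMap.isSelfAdjoint_iff_isSymmetric]
  intro x y
  simp [frameOp_apply, sum_inner, inner_sum, inner_smul_left, inner_smul_right, mul_comm]

/-- The list `λ(S_F)` of eigenvalues of the frame operator (compressed to its range `span F`). -/
def frameEig {n : ℕ} (F : Fin n → H) : ℕ → ℝ :=
  eigList (frameOp F) (frameOp_isSelfAdjoint F) (spanOf F)

/-- `tr S_F`, the sum of the eigenvalues. -/
def frameTrace {n : ℕ} (F : Fin n → H) : ℝ :=
  ∑ k ∈ Finset.range (Module.finrank ℂ (spanOf F)), frameEig F k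

/-- The convex potential `P_h(F)`. -/
def convexPotential {n : ℕ} (h : ℝ → ℝ) (F : Fin n → H) : ℝ :=
  ∑ k ∈ Finset.range (Module.finrank ℂ (spanOf F)), h (frameEig F k)

/-- The optimal duals of `F` in `V` with trace restriction `t`: members of `D_{V,t}(F)` minimizing
simultaneously all convex potentials with non-decreasing `h`. -/
def IsOptimalDual {n : ℕ} (V : Submodule ℂ H) (F : Fin n → H) (t : ℝ) (G : Fin n → H) : Prop :=
  G ∈ obliqueDualsTr V F t ∧ ∀ h : ℝ → ℝ, IsConv h → MonotoneOn h (Set.Ici 0) →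
    ∀ G' ∈ obliqueDualsTr V F t, convexPotential h G ≤ convexPotential h G'

/-- The principal angles between `V` and `W`: `λ(|P_W P_V|) = (cos θ_1, …, cos θ_d, 0, …)` with
`0 ≤ θ_1 ≤ … ≤ θ_d ≤ π/2`; the indices start at `0` here, so `θ_{k+1}` is
`principalAngle V W k`. -/
def principalAngle (V W : Submodule ℂ H) [FiniteDimensional ℂ V] [FiniteDimensional ℂ W]
    (k : ℕ) : ℝ :=
  Real.arccos (eigList (CFC.abs (W.starProjection * V.starProjection))
    (CFC.abs_nonneg _).isSelfAdjoint V k)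

/-- `w_1, …, w_d` are principal vectors in `W` (between `V` and `W`): an orthonormal basis of `W`
with `|P_V P_W| w_i = cos(θ_i) w_i`. -/
def IsPrincipalVectors {d : ℕ} (V W : Submodule ℂ H) [FiniteDimensional ℂ V]
    [FiniteDimensional ℂ W] (w : Fin d → H) : Prop :=
  Orthonormal ℂ w ∧ Submodule.span ℂ (Set.range w) = W ∧
    ∀ i : Fin d, CFC.abs (V.starProjection * W.starProjection) (w i)
      = ((Real.cos (principalAngle V W i) : ℝ) : ℂ) • w i

end ObliqueDual

end

/-! Write `E` for a rotated frame with eigenvalues `l`, and `E#` for its canonical dual. An oblique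
projection along `Wᗮ` is invisible to vectors of `W`, so on `W` the form of `E#` is that of the
inverse of `S_E`, with eigenvalues `l⁻¹`. The same form is the congruence of the operator of `E#` on
`V` by `P_W|_V`, and the Gram operator of that map has eigenvalues `cos² θ_j`. Li and Mathias'
inequality (`prod_le_prod_mul_prod`) then bounds every product of reversed values `l⁻¹ / cos²` by
the product of equally many leading eigenvalues of `E#`. For `U₀` those quotients are exactly the
eigenvalues of the canonical dual (`exists_basis_canonicalDual_principal`), so its spectrum is
log-submajorized, hence submajorized, by every competitor (`partialSums_frameEig_canonicalDual_le`).
The full sums give the trace inequality.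

For the duals, the canonical dual has the least form among all duals
(`sum_norm_sq_canonicalDual_le`), and since `n ≥ 2d` its eigenvalues can be raised arbitrarily
(`exists_obliqueDual_form_eq`). Raising the small ones to a common level until the trace is `t`
gives a spectrum submajorized by that of every admissible dual (`partialSums_max_le`), which proves
optimality and the comparison between `U₀` and `U` for non-decreasing `h`. Optimal duals have trace
exactly `t`. On the positive spectra involved, any convex `h` is a non-decreasing convex function
plus an affine one, and equal traces cancel the affine part. -/

noncomputable section

namespace ObliqueDual

open Finset

/-! ### Majorization and convex functions on the half-line. -/

/-- Abel summation inequality. -/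
theorem sum_mul_nonneg_of_partialSums_nonneg {s z : ℕ → ℝ} {k : ℕ}
    (hs : ∀ i j, i ≤ j → j < k → s j ≤ s i) (hs0 : ∀ i < k, 0 ≤ s i)
    (hz : ∀ j ≤ k, 0 ≤ ∑ i ∈ range j, z i) : 0 ≤ ∑ i ∈ range k, s i * z i := by
  -- The induction needs a bound by the smallest weight times the partial sum, not mere
  -- nonnegativity.
  have key : ∀ j, j < k →
      s j * ∑ i ∈ range (j + 1), z i ≤ ∑ i ∈ range (j + 1), s i * z i := by
    intro j
    induction j with
    | zero => intro _; simp
    | succ j ih =>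
      intro hj
      rw [sum_range_succ _ (j + 1), sum_range_succ _ (j + 1)]
      have h1 := ih (by omega)
      have h2 := mul_le_mul_of_nonneg_right (hs j (j + 1) (by omega) hj) (hz (j + 1) (by omega))
      nlinarith
  rcases k with _ | k
  · simp
  · exact (mul_nonneg (hs0 k (by omega)) (hz _ le_rfl)).trans (key k (by omega))

/-- Log-submajorization implies submajorization. -/
theorem sum_le_sum_of_prod_le_prod {a b : ℕ → ℝ} {k : ℕ}
    (ha : ∀ i j, i ≤ j → j < k → a j ≤ a i) (ha0 : ∀ i < k, 0 < a i) (hb0 : ∀ i < k, 0 < b i)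
    (hab : ∀ j ≤ k, ∏ i ∈ range j, a i ≤ ∏ i ∈ range j, b i) :
    ∑ i ∈ range k, a i ≤ ∑ i ∈ range k, b i := by
  -- The weights are the `a i` themselves, because `a (log b - log a) ≤ b - a`.
  have h := sum_mul_nonneg_of_partialSums_nonneg (s := a)
    (z := fun i => Real.log (b i) - Real.log (a i)) ha (fun i hi => (ha0 i hi).le) (by
      intro j hj
      have hA : ∀ i ∈ range j, 0 < a i := fun i hi => ha0 i ((mem_range.1 hi).trans_le hj)
      have hB : ∀ i ∈ range j, 0 < b i := fun i hi => hb0 i ((mem_range.1 hi).trans_le hj)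
      rw [sum_sub_distrib, ← Real.log_prod fun i hi => (hA i hi).ne',
        ← Real.log_prod fun i hi => (hB i hi).ne', sub_nonneg]
      exact Real.log_le_log (prod_pos hA) (hab j hj))
  rw [← sub_nonneg, ← sum_sub_distrib]
  refine h.trans (sum_le_sum fun i hi => ?_)
  have hai := ha0 i (mem_range.1 hi)
  have hbi := hb0 i (mem_range.1 hi)
  have h1 := Real.log_le_sub_one_of_pos (div_pos hbi hai)
  rw [Real.log_div hbi.ne' hai.ne'] at h1
  calc a i * (Real.log (b i) - Real.log (a i)) ≤ a i * (b i / a i - 1) :=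
        mul_le_mul_of_nonneg_left h1 hai.le
    _ = b i - a i := by field_simp

/-- The right derivative is a subgradient at interior points. -/
theorem mul_rightDeriv_le_sub {h : ℝ → ℝ} (hh : ConvexOn ℝ (Set.Ici 0) h) {x y : ℝ}
    (hx : 0 < x) (hy : 0 ≤ y) : derivWithin h (Set.Ioi x) x * (y - x) ≤ h y - h x := by
  have hxi : x ∈ interior (Set.Ici (0 : ℝ)) := by simpa using hx
  rcases lt_trichotomy x y with hxy | rfl | hxy
  · have h1 := hh.rightDeriv_le_slope_of_mem_interior hxi hy hxy
    rw [slope_def_field, le_div_iff₀ (by linarith)] at h1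
    exact h1
  · simp
  · have h1 := hh.slope_le_leftDeriv_of_mem_interior hy hxi hxy
    have h2 := h1.trans (hh.leftDeriv_le_rightDeriv_of_mem_interior hxi)
    rw [slope_def_field, div_le_iff₀ (by linarith)] at h2
    linarith

theorem rightDeriv_mono {h : ℝ → ℝ} (hh : ConvexOn ℝ (Set.Ici 0) h) {x y : ℝ}
    (hx : 0 < x) (hxy : x ≤ y) :
    derivWithin h (Set.Ioi x) x ≤ derivWithin h (Set.Ioi y) y :=
  hh.monotoneOn_rightDeriv (by simpa using hx) (by simpa using hx.trans_le hxy) hxy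

/-- Submajorization and sums of non-decreasing convex functions. -/
theorem sum_convex_le_sum_of_partialSums_le {h : ℝ → ℝ} (hh : ConvexOn ℝ (Set.Ici 0) h)
    (hm : MonotoneOn h (Set.Ici 0)) {a b : ℕ → ℝ} {k : ℕ}
    (ha : ∀ i j, i ≤ j → j < k → a j ≤ a i) (ha0 : ∀ i < k, 0 < a i) (hb0 : ∀ i < k, 0 ≤ b i)
    (hab : ∀ j ≤ k, ∑ i ∈ range j, a i ≤ ∑ i ∈ range j, b i) :
    ∑ i ∈ range k, h (a i) ≤ ∑ i ∈ range k, h (b i) := by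
  have h0 := sum_mul_nonneg_of_partialSums_nonneg
    (s := fun i => derivWithin h (Set.Ioi (a i)) (a i)) (z := fun i => b i - a i) (k := k)
    (fun i j hij hj => rightDeriv_mono hh (ha0 j hj) (ha i j hij hj))
    -- A subgradient of a non-decreasing function is nonnegative: test it at `0`.
    (fun i hi => by
      have h1 := mul_rightDeriv_le_sub hh (ha0 i hi) le_rfl
      have h2 := hm (Set.mem_Ici.2 le_rfl) (Set.mem_Ici.2 (ha0 i hi).le) (ha0 i hi).le
      have h3 := ha0 i hi
      by_contra hneg
      nlinarith [mul_pos_of_neg_of_neg (not_le.1 hneg) (neg_lt_zero.2 h3)])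
    (fun j hj => by rw [sum_sub_distrib]; linarith [hab j hj])
  rw [← sub_nonneg, ← sum_sub_distrib]
  exact h0.trans (sum_le_sum fun i hi =>
    mul_rightDeriv_le_sub hh (ha0 i (mem_range.1 hi)) (hb0 i (mem_range.1 hi)))

/-- Filling up from below preserves submajorization, provided the total is dominated. -/
theorem partialSums_max_le {a b : ℕ → ℝ} {d : ℕ} {c : ℝ}
    (hb : ∀ i j, i ≤ j → j < d → b j ≤ b i)
    (ha : ∀ i j, i ≤ j → j < d → a j ≤ a i)
    (hab : ∀ j ≤ d, ∑ i ∈ range j, a i ≤ ∑ i ∈ range j, b i)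
    (hd : ∑ i ∈ range d, max (a i) c ≤ ∑ i ∈ range d, b i) :
    ∀ j ≤ d, ∑ i ∈ range j, max (a i) c ≤ ∑ i ∈ range j, b i := by
  intro j
  induction j with
  | zero => simp
  | succ j ih =>
    intro hj
    rcases le_total c (a j) with hc | hc
    · rw [sum_congr rfl fun i hi => max_eq_left
        (hc.trans (ha i j (by simpa [Nat.lt_succ_iff] using hi) (by omega)))]
      exact hab _ hj
    · rcases le_total c (b j) with hcb | hcb
      · rw [sum_range_succ, sum_range_succ, max_eq_right hc]
        linarith [ih (by omega)]
      -- Here the level exceeds `b j`, hence the whole tail of `b`; subtracting the tails from the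
      -- comparison of totals gives the claim.
      · have h1 : ∑ i ∈ Ico (j + 1) d, b i ≤ ∑ i ∈ Ico (j + 1) d, max (a i) c := by
          refine sum_le_sum fun i hi => ?_
          rw [mem_Ico] at hi
          exact (hb j i (by omega) hi.2).trans (hcb.trans (le_max_right _ _))
        rw [← sum_range_add_sum_Ico _ hj, ← sum_range_add_sum_Ico b hj] at hd
        linarith

theorem exists_sum_max_eq {a : ℕ → ℝ} {d : ℕ} (hd : 0 < d) (ha0 : ∀ i < d, 0 < a i) {t : ℝ}
    (ht : ∑ i ∈ range d, a i ≤ t) : ∃ c, ∑ i ∈ range d, max (a i) c = t := by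
  have hcont : Continuous fun c : ℝ => ∑ i ∈ range d, max (a i) c := by fun_prop
  have h0 : ∑ i ∈ range d, max (a i) 0 = ∑ i ∈ range d, a i :=
    sum_congr rfl fun i hi => max_eq_left (ha0 i (mem_range.1 hi)).le
  have ht0 : 0 ≤ t := (sum_nonneg fun i hi => (ha0 i (mem_range.1 hi)).le).trans ht
  have h1 : t ≤ ∑ i ∈ range d, max (a i) t := by
    calc t ≤ d * t := le_mul_of_one_le_left ht0 (by exact_mod_cast hd)
      _ = ∑ i ∈ range d, t := by simp
      _ ≤ _ := sum_le_sum fun i _ => le_max_right _ _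
  obtain ⟨c, -, hc⟩ := intermediate_value_Icc ht0 hcont.continuousOn ⟨h0.trans_le ht, h1⟩
  exact ⟨c, hc⟩

/-- Away from `0`, a convex function differs from a non-decreasing one by an affine function. -/
theorem exists_monotone_isConv {h : ℝ → ℝ} (hh : IsConv h) {m : ℝ} (hm : 0 < m) :
    ∃ (g : ℝ → ℝ) (s c : ℝ), IsConv g ∧ MonotoneOn g (Set.Ici 0) ∧
      ∀ x, m ≤ x → g x = h x - s * x - c := by
  set s := derivWithin h (Set.Ioi m) m with hs
  set k : ℝ → ℝ := fun x => h x - s * x with hk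
  have hkm : ∀ x y, m ≤ x → x ≤ y → k x ≤ k y := by
    intro x y hx hxy
    have h1 := mul_rightDeriv_le_sub hh.1 (hm.trans_le hx) ((hm.trans_le hx).le.trans hxy)
    have h2 := mul_le_mul_of_nonneg_right (rightDeriv_mono hh.1 hm hx) (sub_nonneg.2 hxy)
    simp only [hk]
    linarith
  have hkc : ∀ x y a b : ℝ, m ≤ x → m ≤ y → 0 ≤ a → 0 ≤ b → a + b = 1 →
      k (a * x + b * y) ≤ a * k x + b * k y := by
    intro x y a b hx hy ha hb hab
    have := hh.1.2 (Set.mem_Ici.2 (hm.le.trans hx)) (Set.mem_Ici.2 (hm.le.trans hy)) ha hb hab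
    simp only [smul_eq_mul] at this
    simp only [hk]
    linarith
  -- Subtracting the slope at `m` makes `k` non-decreasing on `[m, ∞)`; freezing it to the left of
  -- `m` and normalizing by `k m` keeps it convex, monotone and nonnegative.
  refine ⟨fun x => k (max x m) - k m, s, k m, ⟨⟨convex_Ici 0, ?_⟩, ?_⟩, ?_, ?_⟩
  · intro x _ y _ a b ha hb hab
    simp only [smul_eq_mul]
    have h1 : max (a * x + b * y) m ≤ a * max x m + b * max y m := by
      refine max_le ?_ ?_
      · gcongr <;> exact le_max_left _ _
      · calc m = a * m + b * m := by rw [← add_mul, hab, one_mul]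
          _ ≤ _ := by gcongr <;> exact le_max_right _ _
    have h2 := hkm _ _ (le_max_right _ _) h1
    have h3 := hkc _ _ a b (le_max_right x m) (le_max_right y m) ha hb hab
    have h4 : k m = a * k m + b * k m := by rw [← add_mul, hab, one_mul]
    linarith
  · intro x _
    exact sub_nonneg.2 (hkm _ _ le_rfl (le_max_right _ _))
  · intro x _ y _ hxy
    exact sub_le_sub_right (hkm _ _ (le_max_right _ _) (max_le_max hxy le_rfl)) _
  · intro x hx
    simp [max_eq_left hx, hk]

/-! ### Quadratic forms, determinants and the multiplicative Lidskii inequality. -/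

section Forms

variable {K : Type*} [NormedAddCommGroup K] [InnerProductSpace ℂ K] {d : ℕ}

/-- Weyl's monotonicity principle for diagonalized quadratic forms. -/
theorem le_of_form_le (y z : OrthonormalBasis (Fin d) ℂ K) {a b : Fin d → ℝ}
    (ha : Antitone a) (hb : Antitone b)
    (h : ∀ x, ∑ j, a j * ‖inner ℂ (y j) x‖ ^ 2 ≤ ∑ j, b j * ‖inner ℂ (z j) x‖ ^ 2)
    (i : Fin d) : a i ≤ b i := by
  have hfd : FiniteDimensional ℂ K := y.toBasis.finiteDimensional_of_finite
  -- Only `d - 1` conditions are imposed, so some nonzero `x` is orthogonal to `z j` for `j < i` and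
  -- to `y j` for `j > i`.
  let L : K →ₗ[ℂ] ({j : Fin d // j ≠ i} → ℂ) := LinearMap.pi fun j =>
    if j.1 < i then (innerSL ℂ (z j.1)).toLinearMap else (innerSL ℂ (y j.1)).toLinearMap
  have hker : LinearMap.ker L ≠ ⊥ := by
    apply LinearMap.ker_ne_bot_of_finrank_lt
    rw [Module.finrank_eq_card_basis y.toBasis, Module.finrank_fintype_fun_eq_card]
    exact Fintype.card_subtype_lt (x := i) (by simp)
  obtain ⟨x, hx, hx0⟩ := (Submodule.ne_bot_iff _).1 hker
  have hLx : ∀ j : {j : Fin d // j ≠ i}, L x j = 0 := fun j => congrFun (LinearMap.mem_ker.1 hx) j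
  have hz : ∀ j, j < i → inner ℂ (z j) x = 0 := fun j hj => by
    simpa [L, hj] using hLx ⟨j, hj.ne⟩
  have hy : ∀ j, i < j → inner ℂ (y j) x = 0 := fun j hj => by
    simpa [L, hj.le.not_gt] using hLx ⟨j, hj.ne'⟩
  have h1 : a i * ‖x‖ ^ 2 ≤ ∑ j, a j * ‖inner ℂ (y j) x‖ ^ 2 := by
    rw [← y.sum_sq_norm_inner_right x, mul_sum]
    refine sum_le_sum fun j _ => ?_
    rcases le_or_gt j i with hj | hj
    · exact mul_le_mul_of_nonneg_right (ha hj) (by positivity)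
    · simp [hy j hj]
  have h2 : ∑ j, b j * ‖inner ℂ (z j) x‖ ^ 2 ≤ b i * ‖x‖ ^ 2 := by
    rw [← z.sum_sq_norm_inner_right x, mul_sum]
    refine sum_le_sum fun j _ => ?_
    rcases lt_or_ge j i with hj | hj
    · simp [hz j hj]
    · exact mul_le_mul_of_nonneg_right (hb hj) (by positivity)
  have hpos : 0 < ‖x‖ ^ 2 := by positivity
  exact le_of_mul_le_mul_right (h1.trans ((h x).trans h2)) hpos

theorem eq_of_form_eq (y z : OrthonormalBasis (Fin d) ℂ K) {a b : Fin d → ℝ}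
    (ha : Antitone a) (hb : Antitone b)
    (h : ∀ x, ∑ j, a j * ‖inner ℂ (y j) x‖ ^ 2 = ∑ j, b j * ‖inner ℂ (z j) x‖ ^ 2) : a = b :=
  funext fun i => le_antisymm (le_of_form_le y z ha hb (fun x => (h x).le) i)
    (le_of_form_le z y hb ha (fun x => (h x).ge) i)

/-- The operator `∑ i, c_i p_i ⊗ p_i`. -/
def diagOp (p : Fin d → K) (c : Fin d → ℝ) : K →ₗ[ℂ] K :=
  ∑ i, (c i : ℂ) • (InnerProductSpace.rankOne ℂ (p i) (p i)).toLinearMap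

theorem diagOp_apply (p : Fin d → K) (c : Fin d → ℝ) (x : K) :
    diagOp p c x = ∑ i, (c i : ℂ) • (inner ℂ (p i) x • p i) := by
  simp [diagOp]

theorem inner_diagOp_self (p : Fin d → K) (c : Fin d → ℝ) (x : K) :
    inner ℂ (diagOp p c x) x = ((∑ i, c i * ‖inner ℂ (p i) x‖ ^ 2 : ℝ) : ℂ) := by
  rw [diagOp_apply, sum_inner]
  push_cast
  refine sum_congr rfl fun i _ => ?_
  rw [inner_smul_left, inner_smul_left, Complex.conj_ofReal, Complex.conj_mul']

theorem diagOp_eq_iff {p q : Fin d → K} {c e : Fin d → ℝ} :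
    diagOp p c = diagOp q e ↔
      ∀ x, ∑ i, c i * ‖inner ℂ (p i) x‖ ^ 2 = ∑ i, e i * ‖inner ℂ (q i) x‖ ^ 2 := by
  rw [← ext_inner_map]
  refine forall_congr' fun x => ?_
  rw [inner_diagOp_self, inner_diagOp_self, Complex.ofReal_inj]

theorem diagOp_isSymmetric (p : Fin d → K) (c : Fin d → ℝ) : (diagOp p c).IsSymmetric := by
  intro x y
  rw [diagOp_apply, diagOp_apply, sum_inner, inner_sum]
  refine sum_congr rfl fun i _ => ?_
  simp only [inner_smul_left, inner_smul_right, Complex.conj_ofReal, inner_conj_symm]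
  ring

theorem exists_eq_diagOp (hd : Module.finrank ℂ K = d) [FiniteDimensional ℂ K] {T : K →ₗ[ℂ] K}
    (hT : T.IsSymmetric) :
    T = diagOp (hT.eigenvectorBasis hd) (hT.eigenvalues hd) := by
  ext x
  rw [diagOp_apply]
  conv_lhs => rw [← (hT.eigenvectorBasis hd).sum_repr' x, map_sum]
  refine sum_congr rfl fun i _ => ?_
  rw [map_smul, hT.apply_eigenvectorBasis, smul_comm]
  rfl

/-- In coordinates the operator is `P* diag(c) P`. The factor `X` does not depend on `c`, so it can
be found from `c = 1`. -/
theorem exists_det_diagOp (e : OrthonormalBasis (Fin d) ℂ K) (p : Fin d → K) :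
    ∃ X : ℂ, ∀ c : Fin d → ℝ, LinearMap.det (diagOp p c) = (∏ i, (c i : ℂ)) * X := by
  let P : Matrix (Fin d) (Fin d) ℂ := Matrix.of fun i j => inner ℂ (p i) (e j)
  refine ⟨P.conjTranspose.det * P.det, fun c => ?_⟩
  have hM : LinearMap.toMatrix e.toBasis e.toBasis (diagOp p c)
      = P.conjTranspose * Matrix.diagonal (fun i => (c i : ℂ)) * P := by
    ext i j
    rw [LinearMap.toMatrix_apply, Matrix.mul_apply]
    simp only [OrthonormalBasis.coe_toBasis, OrthonormalBasis.coe_toBasis_repr_apply,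
      OrthonormalBasis.repr_apply_apply, diagOp_apply, inner_sum, inner_smul_right,
      Matrix.mul_diagonal, Matrix.conjTranspose_apply, P, Matrix.of_apply]
    refine sum_congr rfl fun l _ => ?_
    rw [Complex.star_def, inner_conj_symm]
    ring
  rw [← LinearMap.det_toMatrix e.toBasis, hM, Matrix.det_mul, Matrix.det_mul, Matrix.det_diagonal]
  ring

theorem det_diagOp_basis (z : OrthonormalBasis (Fin d) ℂ K) (c : Fin d → ℝ) :
    LinearMap.det (diagOp z c) = ∏ i, (c i : ℂ) := by
  obtain ⟨X, hX⟩ := exists_det_diagOp z z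
  have h1 : diagOp z (fun _ => 1) = LinearMap.id := by
    ext x
    rw [diagOp_apply]
    simpa using z.sum_repr' x
  have h2 := hX fun _ => 1
  rw [h1, LinearMap.det_id] at h2
  have hX1 : X = 1 := by simpa using h2.symm
  rw [hX, hX1, mul_one]

/-- Li and Mathias' multiplicative Lidskii inequality. -/
theorem prod_le_prod_mul_prod (hd : Module.finrank ℂ K = d) [FiniteDimensional ℂ K]
    {p : Fin d → K} {b : ℕ → ℝ} (hb : ∀ i j, i ≤ j → j < d → b j ≤ b i) (hb0 : ∀ i < d, 0 < b i)
    (y w : OrthonormalBasis (Fin d) ℂ K) {β g : Fin d → ℝ} (hβ : Antitone β) (hg : Antitone g)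
    (hβ0 : ∀ i, 0 < β i) (hg0 : ∀ i, 0 < g i)
    (hpy : ∀ x, ∑ i : Fin d, b i * ‖inner ℂ (p i) x‖ ^ 2 = ∑ j, β j * ‖inner ℂ (y j) x‖ ^ 2)
    (hpw : ∀ x, ∑ i : Fin d, ‖inner ℂ (p i) x‖ ^ 2 = ∑ j, g j * ‖inner ℂ (w j) x‖ ^ 2)
    (J : Finset (Fin d)) :
    ∏ j ∈ J, β j ≤ (∏ j ∈ J, g j) * ∏ i ∈ range J.card, b i := by
  rcases hk : J.card with _ | k
  · simp [card_eq_zero.1 hk]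
  have hkd : k + 1 ≤ d := by simpa [hk] using J.card_le_univ
  -- Raising all weights to at least `m`, the smallest weight in the target product, makes the new
  -- eigenvalues `ρ` dominate both `β` (used on `J`) and `m g` (used on `Jᶜ`). The determinant gives
  -- `∏ ρ` exactly, and the factors over `Jᶜ` cancel.
  set m := b k with hm
  have hm0 : 0 < m := hb0 k hkd
  let c : Fin d → ℝ := fun i => max (b i) m
  have hT := diagOp_isSymmetric p c
  set z := hT.eigenvectorBasis hd
  set ρ := hT.eigenvalues hd
  have hTz : diagOp p c = diagOp z ρ := exists_eq_diagOp hd hT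
  have hform := diagOp_eq_iff.1 hTz
  have hρ : Antitone ρ := hT.eigenvalues_antitone hd
  have h1 : ∀ i, β i ≤ ρ i := le_of_form_le y z hβ hρ fun x => by
    rw [← hpy, ← hform]
    exact sum_le_sum fun i _ => mul_le_mul_of_nonneg_right (le_max_left _ _) (by positivity)
  have h2 : ∀ i, m * g i ≤ ρ i :=
    le_of_form_le w z (fun i j hij => mul_le_mul_of_nonneg_left (hg hij) hm0.le) hρ fun x => by
      simp_rw [mul_assoc]
      rw [← mul_sum, ← hpw, ← hform, mul_sum]
      exact sum_le_sum fun i _ => mul_le_mul_of_nonneg_right (le_max_right _ _) (by positivity)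
  obtain ⟨X, hX⟩ := exists_det_diagOp w p
  have hXg : X = ∏ i, (g i : ℂ) := by
    have h3 : diagOp p (fun _ => 1) = diagOp w g := diagOp_eq_iff.2 (by simpa using hpw)
    have h4 := hX fun _ => 1
    rw [h3, det_diagOp_basis] at h4
    simpa using h4.symm
  have hdet : ∏ i, ρ i = (∏ i, c i) * ∏ i, g i := by
    have h3 := hX c
    rw [hTz, det_diagOp_basis, hXg] at h3
    exact_mod_cast h3
  have hc : ∏ i, c i = (∏ i ∈ range (k + 1), b i) * m ^ (d - (k + 1)) := by
    rw [show ∏ i, c i = ∏ i ∈ range d, max (b i) m from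
      Fin.prod_univ_eq_prod_range (fun i => max (b i) m) d, ← prod_range_mul_prod_Ico _ hkd]
    congr 1
    · exact prod_congr rfl fun i hi => max_eq_left (hb _ _ (by simpa [Nat.lt_succ_iff] using hi) hkd)
    · rw [← Nat.card_Ico, ← prod_const]
      refine prod_congr rfl fun i hi => max_eq_right (hb _ _ ?_ ?_) <;> simp at hi <;> omega
  have hJc : ∏ j ∈ Jᶜ, m * g j = m ^ (d - (k + 1)) * ∏ j ∈ Jᶜ, g j := by
    rw [prod_mul_distrib, prod_const, card_compl, hk, Fintype.card_fin]
  have h5 : (∏ j ∈ J, β j) * ∏ j ∈ Jᶜ, m * g j ≤ ∏ i, ρ i := by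
    rw [← prod_mul_prod_compl J ρ]
    refine mul_le_mul (prod_le_prod (fun i _ => (hβ0 i).le) fun i _ => h1 i)
      (prod_le_prod (fun i _ => (mul_pos hm0 (hg0 i)).le) fun i _ => h2 i)
      (prod_nonneg fun i _ => (mul_pos hm0 (hg0 i)).le)
      (prod_nonneg fun i _ => (hβ0 i).le.trans (h1 i))
  rw [hdet, hc, hJc, ← prod_mul_prod_compl J g] at h5
  refine le_of_mul_le_mul_right (h5.trans_eq ?_)
    (mul_pos (pow_pos hm0 (d - (k + 1))) (prod_pos fun i (_ : i ∈ Jᶜ) => hg0 i))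
  ring

end Forms

/-! ### Spectra of frame operators. -/

section Spectrum

variable {H : Type*} [NormedAddCommGroup H] [InnerProductSpace ℂ H]

theorem inner_frameOp_self {n : ℕ} (F : Fin n → H) (x : H) :
    inner ℂ (frameOp F x) x = ((∑ i, ‖inner ℂ (F i) x‖ ^ 2 : ℝ) : ℂ) := by
  rw [frameOp_apply, sum_inner]
  push_cast
  refine sum_congr rfl fun i _ => ?_
  rw [inner_smul_left, Complex.conj_mul']

theorem inner_compression_self (T : H →L[ℂ] H) (M : Submodule ℂ H) [FiniteDimensional ℂ M]
    (x : M) : inner ℂ (compression T M x) x = inner ℂ (T (x : H)) (x : H) := by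
  change inner ℂ (M.orthogonalProjectionOnto (T x)) x = _
  rw [Submodule.coe_inner]
  have h1 := M.inner_starProjection_left_eq_right (T x) (x : H)
  rwa [Submodule.starProjection_eq_self_iff.mpr x.2] at h1

variable [CompleteSpace H] {n d : ℕ}

theorem eigList_le_eigList (T : H →L[ℂ] H) (hT : IsSelfAdjoint T) (M : Submodule ℂ H)
    [FiniteDimensional ℂ M] {i j : ℕ} (hij : i ≤ j) (hj : j < Module.finrank ℂ M) :
    eigList T hT M j ≤ eigList T hT M i := by
  rw [eigList, eigList, dif_pos hj, dif_pos (hij.trans_lt hj)]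
  exact (compression_isSymmetric hT M).eigenvalues_antitone rfl hij

theorem frameEig_le_frameEig {G : Fin n → H} (hd : Module.finrank ℂ (spanOf G) = d) (i j : ℕ)
    (hij : i ≤ j) (hj : j < d) : frameEig G j ≤ frameEig G i :=
  eigList_le_eigList _ _ _ hij (hd ▸ hj)

theorem frameEig_antitone {G : Fin n → H} (hd : Module.finrank ℂ (spanOf G) = d) :
    Antitone fun k : Fin d => frameEig G k :=
  fun i j hij => frameEig_le_frameEig hd i j hij j.2

variable {V : Submodule ℂ H} {G : Fin n → H}

/-- Diagonalization of the quadratic form of a frame operator. -/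
theorem exists_basis_frameEig (hG : spanOf G = V) (hd : Module.finrank ℂ V = d) :
    ∃ u : OrthonormalBasis (Fin d) ℂ V, ∀ x : V,
      ∑ i, ‖inner ℂ (G i) (x : H)‖ ^ 2 = ∑ k : Fin d, frameEig G k * ‖inner ℂ (u k) x‖ ^ 2 := by
  subst hG hd
  have hT := compression_isSymmetric (frameOp_isSelfAdjoint G) (spanOf G)
  refine ⟨hT.eigenvectorBasis rfl, fun x => ?_⟩
  have h1 := inner_frameOp_self G (x : H)
  rw [← inner_compression_self, exists_eq_diagOp rfl hT, inner_diagOp_self,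
    Complex.ofReal_inj] at h1
  rw [← h1]
  refine sum_congr rfl fun k _ => ?_
  rw [frameEig, eigList, dif_pos k.2]

theorem frameEig_eq_of_form (hG : spanOf G = V) (z : OrthonormalBasis (Fin d) ℂ V)
    {μ : Fin d → ℝ} (hμ : Antitone μ)
    (h : ∀ x : V, ∑ i, ‖inner ℂ (G i) (x : H)‖ ^ 2 = ∑ k, μ k * ‖inner ℂ (z k) x‖ ^ 2)
    (k : Fin d) : frameEig G k = μ k := by
  have hd : Module.finrank ℂ V = d := by simpa using Module.finrank_eq_card_basis z.toBasis
  obtain ⟨u, hu⟩ := exists_basis_frameEig hG hd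
  exact congrFun (eq_of_form_eq u z (frameEig_antitone (hG ▸ hd)) hμ
    fun x => (hu x).symm.trans (h x)) k

/-- Needed for the aligned canonical dual, whose eigenvalues multiply a decreasing by an increasing
sequence and so come unsorted. -/
theorem exists_perm_frameEig_eq (hG : spanOf G = V) (z : OrthonormalBasis (Fin d) ℂ V)
    {μ : Fin d → ℝ}
    (h : ∀ x : V, ∑ i, ‖inner ℂ (G i) (x : H)‖ ^ 2 = ∑ k, μ k * ‖inner ℂ (z k) x‖ ^ 2) :
    ∃ σ : Equiv.Perm (Fin d), ∀ k : Fin d, frameEig G k = μ (σ k) := by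
  let σ : Equiv.Perm (Fin d) := Tuple.sort fun k => -μ k
  have hσ : Antitone (μ ∘ σ) := fun i j hij => by
    simpa using Tuple.monotone_sort (fun k => -μ k) hij
  refine ⟨σ, frameEig_eq_of_form hG (z.reindex σ.symm) hσ fun x => ?_⟩
  rw [h, ← Equiv.sum_comp σ]
  simp

/-- An eigenvector for the value `0` would be orthogonal to every `G i`, hence to `V`, which
contains it. -/
theorem frameEig_pos (hG : spanOf G = V) (hd : Module.finrank ℂ V = d) (k : ℕ) (hk : k < d) :
    0 < frameEig G k := by
  obtain ⟨u, hu⟩ := exists_basis_frameEig hG hd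
  have h1 := hu (u ⟨k, hk⟩)
  have h2 : ∑ j : Fin d, frameEig G j * ‖inner ℂ (u j) (u ⟨k, hk⟩)‖ ^ 2 = frameEig G k := by
    rw [sum_eq_single ⟨k, hk⟩]
    · simp
    · intro j _ hj
      simp [u.inner_eq_zero hj]
    · simp
  rw [h2] at h1
  rw [← h1]
  refine lt_of_le_of_ne (by positivity) fun h0 => ?_
  have h3 : ∀ i, inner ℂ (G i) (u ⟨k, hk⟩ : H) = 0 := fun i => by
    have := (sum_eq_zero_iff_of_nonneg fun i _ => by positivity).1 h0.symm i (mem_univ i)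
    simpa using this
  have h4 : (u ⟨k, hk⟩ : H) ∈ (spanOf G)ᗮ := by
    rw [Submodule.mem_orthogonal]
    intro v hv
    induction hv using Submodule.span_induction with
    | mem v hv => obtain ⟨i, rfl⟩ := hv; exact h3 i
    | zero => simp
    | add v w _ _ hv hw => rw [inner_add_left, hv, hw, add_zero]
    | smul a v _ hv => rw [inner_smul_left, hv, mul_zero]
  have h5 : inner ℂ (u ⟨k, hk⟩ : H) (u ⟨k, hk⟩ : H) = 0 :=
    (Submodule.mem_orthogonal _ _).1 h4 _ (by rw [hG]; exact (u ⟨k, hk⟩).2)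
  have h6 : u ⟨k, hk⟩ = 0 := Subtype.ext (inner_self_eq_zero.1 h5)
  exact u.orthonormal.ne_zero _ h6

theorem frameTrace_eq (hG : spanOf G = V) (hd : Module.finrank ℂ V = d) :
    frameTrace G = ∑ k ∈ range d, frameEig G k := by
  rw [frameTrace, hG, hd]

theorem convexPotential_eq (hG : spanOf G = V) (hd : Module.finrank ℂ V = d) (h : ℝ → ℝ) :
    convexPotential h G = ∑ k ∈ range d, h (frameEig G k) := by
  rw [convexPotential, hG, hd]

theorem sum_frameEig_eq_sum_norm_sq (hG : spanOf G = V) (hd : Module.finrank ℂ V = d) :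
    ∑ k ∈ range d, frameEig G k = ∑ i, ‖G i‖ ^ 2 := by
  obtain ⟨u, hu⟩ := exists_basis_frameEig hG hd
  have hmem : ∀ i, G i ∈ V := fun i => hG ▸ Submodule.subset_span ⟨i, rfl⟩
  have h1 : ∀ i, ‖G i‖ ^ 2 = ∑ j, ‖inner ℂ (G i) (u j : H)‖ ^ 2 := fun i =>
    (u.sum_sq_norm_inner_left ⟨G i, hmem i⟩).symm
  simp_rw [h1]
  rw [sum_comm, ← Fin.sum_univ_eq_sum_range]
  refine sum_congr rfl fun k _ => ?_
  rw [hu, sum_eq_single k]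
  · simp
  · intro j _ hj
    simp [u.inner_eq_zero hj]
  · simp

end Spectrum

/-! ### Oblique duals and the canonical dual. -/

section Duals

variable {H : Type*} [NormedAddCommGroup H] [InnerProductSpace ℂ H] {n d : ℕ}

theorem mem_orthogonal_spanOf_iff {E : Fin n → H} {x : H} :
    x ∈ (spanOf E)ᗮ ↔ ∀ i, inner ℂ (E i) x = 0 := by
  rw [Submodule.mem_orthogonal]
  refine ⟨fun h i => h _ (Submodule.subset_span ⟨i, rfl⟩), fun h v hv => ?_⟩
  induction hv using Submodule.span_induction with
  | mem v hv => obtain ⟨i, rfl⟩ := hv; exact h i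
  | zero => simp
  | add v w _ _ hv hw => rw [inner_add_left, hv, hw, add_zero]
  | smul a v _ hv => rw [inner_smul_left, hv, mul_zero]

theorem mem_orthogonal_spanOf_of_frameOp_eq_zero {E : Fin n → H} {x : H}
    (hx : frameOp E x = 0) : x ∈ (spanOf E)ᗮ := by
  have h1 := inner_frameOp_self E x
  rw [hx, inner_zero_left] at h1
  have h2 : ∑ i, ‖inner ℂ (E i) x‖ ^ 2 = 0 := by exact_mod_cast h1.symm
  rw [mem_orthogonal_spanOf_iff]
  intro i
  simpa using (sum_eq_zero_iff_of_nonneg fun i _ => by positivity).1 h2 i (mem_univ i)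

theorem frameOp_eq_zero_of_mem {E : Fin n → H} {x : H} (hx : x ∈ (spanOf E)ᗮ) :
    frameOp E x = 0 := by
  rw [frameOp_apply]
  exact sum_eq_zero fun i _ => by rw [mem_orthogonal_spanOf_iff.1 hx i, zero_smul]

theorem sum_mul_norm_sq_eq_of_eigen {E : Fin n → H} {y : Fin d → H} (hyo : Orthonormal ℂ y)
    {l : Fin d → ℝ} (hy : ∀ j, frameOp E (y j) = (l j : ℂ) • y j) (c : Fin d → ℂ) :
    ∑ i, ‖inner ℂ (E i) (∑ j, c j • y j)‖ ^ 2 = ∑ j, l j * ‖c j‖ ^ 2 := by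
  have h1 := inner_frameOp_self E (∑ j, c j • y j)
  have h2 : frameOp E (∑ j, c j • y j) = ∑ j, (l j * c j : ℂ) • y j := by
    rw [map_sum]
    refine sum_congr rfl fun j _ => ?_
    rw [map_smul, hy, smul_smul, mul_comm]
  rw [h2, hyo.inner_sum] at h1
  have h3 : ∑ j, (starRingEnd ℂ) ((l j : ℂ) * c j) * c j
      = ((∑ j, l j * ‖c j‖ ^ 2 : ℝ) : ℂ) := by
    push_cast
    refine sum_congr rfl fun j _ => ?_
    rw [map_mul, Complex.conj_ofReal, mul_assoc, Complex.conj_mul']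
  rw [h3] at h1
  exact_mod_cast h1.symm

/-- Every oblique dual spans `V`. -/
theorem spanOf_eq_of_mem_obliqueDuals {V : Submodule ℂ H} {E G : Fin n → H}
    (hG : G ∈ obliqueDuals V E) : spanOf G = V := by
  refine le_antisymm (Submodule.span_le.2 ?_) fun g hg => ?_
  · rintro _ ⟨i, rfl⟩
    exact hG.1 i
  · rw [hG.2 g hg]
    exact Submodule.sum_mem _ fun i _ => Submodule.smul_mem _ _ (Submodule.subset_span ⟨i, rfl⟩)

theorem sum_inner_smul_eq_projection {V W : Submodule ℂ H} (hVW : IsCompl V Wᗮ)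
    {E : Fin n → H} (hE : spanOf E = W) {G : Fin n → H}
    (hG : G ∈ obliqueDuals V E) (g : H) :
    ∑ i, inner ℂ (E i) g • G i = V.projection Wᗮ hVW g := by
  rw [hG.2 _ (Submodule.projection_apply_mem hVW g)]
  refine sum_congr rfl fun i _ => ?_
  have h1 : g - V.projection Wᗮ hVW g ∈ (spanOf E)ᗮ := by
    rw [hE]; exact Submodule.sub_projection_mem hVW g
  have h2 := mem_orthogonal_spanOf_iff.1 h1 i
  rw [inner_sub_right, sub_eq_zero] at h2
  rw [h2]

/-- The analysis operator kills `Wᗮ`, so its range has dimension at most `d`; the complement in `ℂⁿ`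
has dimension at least `n - d ≥ d`. -/
theorem exists_orthonormal_orthogonal_analysis {W : Submodule ℂ H} [FiniteDimensional ℂ W]
    {E : Fin n → H} (hE : spanOf E = W) (hd : Module.finrank ℂ W = d) (hn : 2 * d ≤ n) :
    ∃ e : Fin d → EuclideanSpace ℂ (Fin n), Orthonormal ℂ e ∧
      ∀ j g, ∑ i, inner ℂ (E i) g * (starRingEnd ℂ) (e j i) = 0 := by
  let T : H →ₗ[ℂ] EuclideanSpace ℂ (Fin n) :=
    (WithLp.linearEquiv 2 ℂ (Fin n → ℂ)).symm.toLinearMap ∘ₗ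
      LinearMap.pi fun i => (innerSL ℂ (E i)).toLinearMap
  have hT : ∀ g i, T g i = inner ℂ (E i) g := fun g i => rfl
  let R := W.map T
  have hmem : ∀ g, T g ∈ R := fun g => by
    refine ⟨W.starProjection g, by simp, ?_⟩
    ext i
    have h1 : g - W.starProjection g ∈ (spanOf E)ᗮ := by
      rw [hE]; exact W.sub_starProjection_mem_orthogonal g
    have h2 := mem_orthogonal_spanOf_iff.1 h1 i
    rw [inner_sub_right, sub_eq_zero] at h2
    exact h2.symm
  have hR : Module.finrank ℂ R ≤ d := hd ▸ Submodule.finrank_map_le T W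
  have hRo : d ≤ Module.finrank ℂ Rᗮ := by
    have := R.finrank_add_finrank_orthogonal
    rw [finrank_euclideanSpace_fin] at this
    omega
  let b := stdOrthonormalBasis ℂ Rᗮ
  refine ⟨fun j => (b (Fin.castLE hRo j) : EuclideanSpace ℂ (Fin n)), ?_, fun j g => ?_⟩
  · exact (b.orthonormal.comp _ (Fin.castLE_injective hRo)).comp_linearIsometry Rᗮ.subtypeₗᵢ
  · have h1 : inner ℂ (b (Fin.castLE hRo j) : EuclideanSpace ℂ (Fin n)) (T g) = 0 :=
      Submodule.inner_left_of_mem_orthogonal (hmem g) (b (Fin.castLE hRo j)).2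
    rw [PiLp.inner_apply] at h1
    exact h1

variable [CompleteSpace H] {V W : Submodule ℂ H}

theorem frameOpPinv_frameOp_sub_mem (E : Fin n → H) (x : H) :
    frameOpPinv E (frameOp E x) - x ∈ (spanOf E)ᗮ := by
  refine mem_orthogonal_spanOf_of_frameOp_eq_zero ?_
  rw [map_sub, sub_eq_zero]
  exact congrArg (fun T : H →L[ℂ] H => T x) (frameOpPinv_spec E).1

/-- `S†S` is self-adjoint and kills `(spanOf E)ᗮ`, so its range is orthogonal to that space. -/
theorem frameOpPinv_frameOp_mem (E : Fin n → H) (x : H) :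
    frameOpPinv E (frameOp E x) ∈ spanOf E := by
  rw [← Submodule.orthogonal_orthogonal (spanOf E), Submodule.mem_orthogonal]
  intro k hk
  have hs := ContinuousLinearMap.isSelfAdjoint_iff_isSymmetric.mp (frameOpPinv_spec E).2.2.2
  have h1 : inner ℂ (frameOpPinv E (frameOp E k)) x = inner ℂ k (frameOpPinv E (frameOp E x)) :=
    hs k x
  rw [← h1, frameOp_eq_zero_of_mem hk, map_zero, inner_zero_left]

theorem frameOpPinv_frameOp_of_mem {E : Fin n → H} {x : H} (hx : x ∈ spanOf E) :
    frameOpPinv E (frameOp E x) = x := by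
  have h1 := Submodule.sub_mem _ (frameOpPinv_frameOp_mem E x) hx
  have h2 := (Submodule.orthogonal_disjoint (spanOf E)).le_bot
    ⟨h1, frameOpPinv_frameOp_sub_mem E x⟩
  exact sub_eq_zero.1 (by simpa using h2)

theorem frameOpPinv_eigen {E : Fin n → H} {x : H} (hx : x ∈ spanOf E) {l : ℝ} (hl : l ≠ 0)
    (h : frameOp E x = (l : ℂ) • x) : frameOpPinv E x = ((l⁻¹ : ℝ) : ℂ) • x := by
  have h1 := frameOpPinv_frameOp_of_mem hx
  rw [h, map_smul] at h1
  conv_rhs => rw [← h1, smul_smul]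
  simp [hl]

variable (hVW : IsCompl V Wᗮ) {E : Fin n → H}

theorem canonicalDual_mem_obliqueDuals (hE : spanOf E = W) :
    canonicalDual V W hVW E ∈ obliqueDuals V E := by
  refine ⟨fun i => Submodule.projection_apply_mem _ _, fun g hg => ?_⟩
  have h1 : ∑ i, inner ℂ (E i) g • canonicalDual V W hVW E i
      = V.projection Wᗮ hVW (frameOpPinv E (frameOp E g)) := by
    simp only [canonicalDual, frameOp_apply, map_sum, map_smul]
  have h2 := (Submodule.projection_apply_eq_zero_iff hVW).2
    (hE ▸ frameOpPinv_frameOp_sub_mem E g : frameOpPinv E (frameOp E g) - g ∈ Wᗮ)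
  rw [map_sub, sub_eq_zero, Submodule.projection_apply_of_mem_left hVW hg] at h2
  rw [h1, h2]

theorem spanOf_canonicalDual (hE : spanOf E = W) : spanOf (canonicalDual V W hVW E) = V :=
  spanOf_eq_of_mem_obliqueDuals (canonicalDual_mem_obliqueDuals hVW hE)

section Eigenbasis

variable (hE : spanOf E = W) (y : OrthonormalBasis (Fin d) ℂ W) {l : Fin d → ℝ}
  (hl : ∀ j, 0 < l j) (hy : ∀ j, frameOp E (y j) = (l j : ℂ) • (y j : H))

include hE hl hy

/-- Moving `P S†` to its adjoint shows that the analysis coefficients of the canonical dual lie in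
the range of the analysis operator of `E`. -/
theorem inner_canonicalDual (i : Fin n) (x : H) :
    inner ℂ (canonicalDual V W hVW E i) x = inner ℂ (E i)
      (∑ j, (((l j)⁻¹ : ℝ) : ℂ) • inner ℂ (V.projection Wᗮ hVW (y j)) x • (y j : H)) := by
  have hEi : E i ∈ W := hE ▸ Submodule.subset_span ⟨i, rfl⟩
  have h1 : E i = ∑ j, inner ℂ (y j : H) (E i) • (y j : H) := by
    have := congrArg (Submodule.subtype W) (y.sum_repr' ⟨E i, hEi⟩)
    simpa using this.symm
  have h2 : frameOpPinv E (E i)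
      = ∑ j, inner ℂ (y j : H) (E i) • (((l j)⁻¹ : ℝ) : ℂ) • (y j : H) := by
    conv_lhs => rw [h1]
    rw [map_sum]
    refine sum_congr rfl fun j _ => ?_
    rw [map_smul, frameOpPinv_eigen (hE ▸ (y j).2) (hl j).ne' (hy j)]
  rw [canonicalDual, h2, map_sum, sum_inner, inner_sum]
  refine sum_congr rfl fun j _ => ?_
  rw [map_smul, map_smul, inner_smul_left, inner_smul_left, inner_smul_right, inner_smul_right,
    inner_conj_symm, Complex.conj_ofReal]
  ring

/-- Pythagoras in `ℂⁿ`: by `hr` the coefficients of `r` are orthogonal to the analysis range of `E`,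
which contains those of the canonical dual. -/
theorem sum_norm_sq_add_eq {r : Fin n → H} (hr : ∀ g, ∑ i, inner ℂ (E i) g • r i = 0) (x : H) :
    ∑ i, ‖inner ℂ (canonicalDual V W hVW E i + r i) x‖ ^ 2
      = ∑ i, ‖inner ℂ (canonicalDual V W hVW E i) x‖ ^ 2 + ∑ i, ‖inner ℂ (r i) x‖ ^ 2 := by
  have hcross : ∑ i, (starRingEnd ℂ) (inner ℂ (canonicalDual V W hVW E i) x) * inner ℂ (r i) x
      = 0 := by
    have h1 := congrArg (fun v => inner ℂ v x) (hr
      (∑ j, (((l j)⁻¹ : ℝ) : ℂ) • inner ℂ (V.projection Wᗮ hVW (y j)) x • (y j : H)))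
    simp only [sum_inner, inner_smul_left, inner_zero_left] at h1
    rw [← h1]
    exact sum_congr rfl fun i _ => by rw [inner_canonicalDual hVW hE y hl hy]
  have hre : ∑ i, 2 * RCLike.re ((starRingEnd ℂ) (inner ℂ (canonicalDual V W hVW E i) x)
      * inner ℂ (r i) x) = 0 := by
    rw [← mul_sum, ← map_sum, hcross]; simp
  rw [← sum_add_distrib, ← sub_eq_zero, ← sum_sub_distrib, ← hre]
  refine sum_congr rfl fun i _ => ?_
  rw [inner_add_left]
  have h1 := @norm_add_sq ℂ ℂ _ _ _ (inner ℂ (canonicalDual V W hVW E i) x) (inner ℂ (r i) x)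
  rw [h1, RCLike.inner_apply]
  rw [mul_comm ((starRingEnd ℂ) _)]
  ring

/-- The canonical dual has the smallest frame operator among the oblique duals. -/
theorem sum_norm_sq_canonicalDual_le {G : Fin n → H} (hG : G ∈ obliqueDuals V E) (x : H) :
    ∑ i, ‖inner ℂ (canonicalDual V W hVW E i) x‖ ^ 2 ≤ ∑ i, ‖inner ℂ (G i) x‖ ^ 2 := by
  have h1 := sum_norm_sq_add_eq hVW hE y hl hy (r := fun i => G i - canonicalDual V W hVW E i)
    (fun g => by
      simp_rw [smul_sub]
      rw [sum_sub_distrib, sum_inner_smul_eq_projection hVW hE hG,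
        sum_inner_smul_eq_projection hVW hE (canonicalDual_mem_obliqueDuals hVW hE), sub_self]) x
  simp only [add_sub_cancel] at h1
  rw [h1]
  exact le_add_of_nonneg_right (by positivity)

/-- The projection moves a vector only by an element of `Wᗮ`, so pairing with `x ∈ W` does not see
it and the form of `S†` remains. -/
theorem sum_norm_sq_canonicalDual (x : W) :
    ∑ i, ‖inner ℂ (canonicalDual V W hVW E i) (x : H)‖ ^ 2
      = ∑ j, (l j)⁻¹ * ‖inner ℂ (y j) x‖ ^ 2 := by
  have h1 : ∀ j, inner ℂ (V.projection Wᗮ hVW (y j)) (x : H) = inner ℂ (y j) x := fun j => by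
    have h2 := Submodule.inner_left_of_mem_orthogonal x.2
      (Submodule.sub_projection_mem hVW (y j : H))
    rw [inner_sub_left, sub_eq_zero] at h2
    exact h2.symm
  simp_rw [inner_canonicalDual hVW hE y hl hy, h1, smul_smul]
  rw [sum_mul_norm_sq_eq_of_eigen (y := fun j => (y j : H))
    (y.orthonormal.comp_linearIsometry W.subtypeₗᵢ) hy]
  refine sum_congr rfl fun j _ => ?_
  rw [norm_mul, mul_pow, Complex.norm_real, Real.norm_eq_abs, sq_abs]
  have := (hl j).ne'
  field_simp

/-- Prescribing the eigenvalues of a dual above those of the canonical dual. -/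
theorem exists_obliqueDual_form_eq (hn : 2 * d ≤ n) (u : OrthonormalBasis (Fin d) ℂ V)
    {a b : Fin d → ℝ} (hab : a ≤ b)
    (hu : ∀ x : V, ∑ i, ‖inner ℂ (canonicalDual V W hVW E i) (x : H)‖ ^ 2
      = ∑ k, a k * ‖inner ℂ (u k) x‖ ^ 2) :
    ∃ G ∈ obliqueDuals V E, ∀ x : V, ∑ i, ‖inner ℂ (G i) (x : H)‖ ^ 2
      = ∑ k, b k * ‖inner ℂ (u k) x‖ ^ 2 := by
  have := y.toBasis.finiteDimensional_of_finite
  obtain ⟨e, heo, he⟩ := exists_orthonormal_orthogonal_analysis hE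
    (by simpa using Module.finrank_eq_card_basis y.toBasis) hn
  -- The coefficient vectors `e j` make `r` a perturbation that keeps duality; orthonormality and
  -- the weights `√(b j - a j)` give it the form `∑ (b j - a j) |⟨u j, x⟩|²`.
  let r : Fin n → H := fun i =>
    ∑ j, ((√(b j - a j) : ℝ) * (starRingEnd ℂ) (e j i) : ℂ) • (u j : H)
  have hr : ∀ g, ∑ i, inner ℂ (E i) g • r i = 0 := fun g => by
    simp only [r, smul_sum]
    rw [sum_comm]
    refine sum_eq_zero fun j _ => ?_
    simp only [smul_smul]
    rw [← sum_smul]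
    have : ∑ i, inner ℂ (E i) g * ((√(b j - a j) : ℝ) * (starRingEnd ℂ) (e j i))
        = (√(b j - a j) : ℝ) * ∑ i, inner ℂ (E i) g * (starRingEnd ℂ) (e j i) := by
      rw [mul_sum]
      exact sum_congr rfl fun i _ => by ring
    rw [this, he, mul_zero, zero_smul]
  have hcan := canonicalDual_mem_obliqueDuals hVW hE
  refine ⟨fun i => canonicalDual V W hVW E i + r i, ⟨fun i => V.add_mem (hcan.1 i)
    (Submodule.sum_mem _ fun j _ => Submodule.smul_mem _ _ (u j).2), fun g hg => ?_⟩,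
    fun x => ?_⟩
  · simp_rw [smul_add]
    rw [sum_add_distrib, hr, add_zero]
    exact hcan.2 g hg
  · rw [sum_norm_sq_add_eq hVW hE y hl hy hr, hu]
    let v : EuclideanSpace ℂ (Fin n) :=
      ∑ j, ((√(b j - a j) : ℝ) * inner ℂ (u j) x : ℂ) • e j
    have hv : ∀ i, v i = inner ℂ (r i) (x : H) := fun i => by
      simp only [v, r, sum_inner, inner_smul_left, WithLp.ofLp_sum, WithLp.ofLp_smul,
        Finset.sum_apply, Pi.smul_apply, smul_eq_mul, map_mul, Complex.conj_ofReal,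
        Complex.conj_conj, Submodule.coe_inner]
      exact sum_congr rfl fun j _ => by ring
    have h1 : ∑ i, ‖inner ℂ (r i) (x : H)‖ ^ 2
        = ∑ j, (b j - a j) * ‖inner ℂ (u j) x‖ ^ 2 := by
      simp_rw [← hv]
      rw [← EuclideanSpace.norm_sq_eq]
      have h2 : ((‖v‖ ^ 2 : ℝ) : ℂ) = inner ℂ v v := by
        rw [inner_self_eq_norm_sq_to_K]; norm_cast
      rw [heo.inner_sum] at h2
      have h3 : ∀ j, (starRingEnd ℂ) ((√(b j - a j) : ℝ) * inner ℂ (u j) x : ℂ)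
          * ((√(b j - a j) : ℝ) * inner ℂ (u j) x : ℂ)
          = (((b j - a j) * ‖inner ℂ (u j) x‖ ^ 2 : ℝ) : ℂ) := fun j => by
        rw [Complex.conj_mul', norm_mul, Complex.norm_real, Real.norm_eq_abs]
        rw [← Complex.ofReal_pow, mul_pow, sq_abs, Real.sq_sqrt (sub_nonneg.2 (hab j))]
      simp_rw [h3] at h2
      exact_mod_cast h2
    rw [h1, ← sum_add_distrib]
    exact sum_congr rfl fun k _ => by ring

end Eigenbasis

end Duals

/-! ### Principal vectors and the spectrum of the canonical dual. -/

section Principal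

variable {H : Type*} [NormedAddCommGroup H] [InnerProductSpace ℂ H] {n d : ℕ}

theorem exists_orthonormalBasis_of_span_eq {W : Submodule ℂ H} {w : Fin d → H}
    (hw : Orthonormal ℂ w) (hW : Submodule.span ℂ (Set.range w) = W) :
    ∃ b : OrthonormalBasis (Fin d) ℂ W, ∀ j, (b j : H) = w j := by
  subst hW
  let v : Fin d → Submodule.span ℂ (Set.range w) := fun j => ⟨w j, Submodule.subset_span ⟨j, rfl⟩⟩
  have hv : Orthonormal ℂ v :=
    (LinearIsometry.orthonormal_comp_iff (Submodule.span ℂ (Set.range w)).subtypeₗᵢ).1 hw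
  have htop : Submodule.span ℂ (Set.range v) = ⊤ :=
    hv.linearIndependent.span_eq_top_of_card_eq_finrank'
      (finrank_span_eq_card hw.linearIndependent).symm
  exact ⟨OrthonormalBasis.mk hv htop.ge, fun j => by simp [v]⟩

theorem spanOf_eq_of_isFrameFor {W : Submodule ℂ H} {F : Fin n → H} (hF : IsFrameFor W F) :
    spanOf F = W := by
  obtain ⟨hFW, A, B, hA, -, hAB⟩ := hF
  have hle : spanOf F ≤ W := by
    rw [Submodule.span_le]
    rintro _ ⟨i, rfl⟩
    exact hFW i
  refine le_antisymm hle fun x hx => ?_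
  -- The lower frame bound forces this component, orthogonal to all `F i`, to vanish.
  set z := x - (spanOf F).starProjection x
  have hz : z ∈ (spanOf F)ᗮ := (spanOf F).sub_starProjection_mem_orthogonal x
  have hzW : z ∈ W := W.sub_mem hx (hle (by simp))
  have h1 := (hAB z hzW).1
  simp only [mem_orthogonal_spanOf_iff.1 hz, norm_zero] at h1
  have h2 : ‖z‖ ^ 2 ≤ 0 := by
    by_contra hneg
    have := mul_pos hA (not_le.1 hneg)
    simp at h1
    linarith
  have h3 : z = 0 := by simpa using le_antisymm h2 (by positivity)
  rw [sub_eq_zero.1 h3]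
  simp

theorem spanOf_rotate (U : H ≃ₗᵢ[ℂ] H) (F : Fin n → H) :
    spanOf (rotate U F) = (spanOf F).map U.toLinearEquiv.toLinearMap := by
  rw [spanOf, spanOf, Submodule.map_span, ← Set.range_comp]
  rfl

theorem frameOp_rotate_apply (U : H ≃ₗᵢ[ℂ] H) (F : Fin n → H) (x : H) :
    frameOp (rotate U F) (U x) = U (frameOp F x) := by
  simp [frameOp_apply, rotate]

variable {V W : Submodule ℂ H} [FiniteDimensional ℂ V]

theorem inner_starProjection_right_of_mem {x : H} (hx : x ∈ V) (y : H) :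
    inner ℂ x (V.starProjection y) = inner ℂ x y := by
  rw [← V.inner_starProjection_left_eq_right, Submodule.starProjection_eq_self_iff.mpr hx]

/-- Such an `x` is orthogonal to both `V` and `Wᗮ`, which together span `H`. -/
theorem eq_zero_of_mem_of_starProjection_eq_zero (hVW : IsCompl V Wᗮ) {x : H} (hx : x ∈ W)
    (h : V.starProjection x = 0) : x = 0 := by
  have h1 : x ∈ Vᗮ := by rwa [← V.starProjection_apply_eq_zero_iff]
  have h2 : x ∈ (V ⊔ Wᗮ)ᗮ := by
    rw [← Submodule.inf_orthogonal]
    exact ⟨h1, Submodule.le_orthogonal_orthogonal W hx⟩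
  rw [hVW.sup_eq_top, Submodule.top_orthogonal_eq_bot] at h2
  simpa using h2

variable [FiniteDimensional ℂ W]

theorem finrank_eq_of_isCompl_orthogonal (hVW : IsCompl V Wᗮ) :
    Module.finrank ℂ V = Module.finrank ℂ W := by
  refine le_antisymm ?_ ?_
  · refine LinearMap.finrank_le_finrank_of_injective
      (f := W.orthogonalProjectionOnto.toLinearMap ∘ₗ V.subtype) ?_
    rw [← LinearMap.ker_eq_bot, LinearMap.ker_eq_bot']
    intro x hx
    have h1 : (x : H) ∈ Wᗮ := by
      rw [← W.starProjection_apply_eq_zero_iff]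
      exact congrArg Subtype.val hx
    exact Subtype.ext ((Submodule.mem_bot ℂ).1 (hVW.disjoint.le_bot ⟨x.2, h1⟩))
  · refine LinearMap.finrank_le_finrank_of_injective
      (f := V.orthogonalProjectionOnto.toLinearMap ∘ₗ W.subtype) ?_
    rw [← LinearMap.ker_eq_bot, LinearMap.ker_eq_bot']
    intro x hx
    exact Subtype.ext (eq_zero_of_mem_of_starProjection_eq_zero hVW x.2
      (congrArg Subtype.val hx))

variable [CompleteSpace H]

theorem cos_principalAngle_antitone (hd : Module.finrank ℂ V = d) :
    Antitone fun j : Fin d => Real.cos (principalAngle V W j) := fun i j hij =>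
  Real.cos_le_cos_of_nonneg_of_le_pi (Real.arccos_nonneg _) (Real.arccos_le_pi _)
    (Real.arccos_le_arccos (eigList_le_eigList _ _ _ hij (hd ▸ j.2)))

/-- Square the eigenvalue equation, using `|P_V P_W|² = P_W P_V P_W`. -/
theorem starProjection_starProjection_principal {w : Fin d → H} (hw : IsPrincipalVectors V W w)
    (j : Fin d) : W.starProjection (V.starProjection (w j))
      = ((Real.cos (principalAngle V W j) ^ 2 : ℝ) : ℂ) • w j := by
  have hjW : w j ∈ W := hw.2.1 ▸ Submodule.subset_span ⟨j, rfl⟩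
  have h1 := congrArg (fun T : H →L[ℂ] H => T (w j))
    (CFC.abs_mul_abs (V.starProjection * W.starProjection))
  rw [star_mul, (isSelfAdjoint_starProjection V).star_eq,
    (isSelfAdjoint_starProjection W).star_eq] at h1
  simp only [ContinuousLinearMap.mul_def, ContinuousLinearMap.comp_apply] at h1
  rw [Submodule.starProjection_eq_self_iff.mpr hjW] at h1
  rw [Submodule.starProjection_eq_self_iff.mpr (V.starProjection_apply_mem (w j))] at h1
  rw [← h1]
  have h2 := hw.2.2 j
  rw [ContinuousLinearMap.mul_def] at h2
  rw [h2, map_smul, h2, smul_smul]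
  congr 1
  push_cast
  ring

theorem inner_starProjection_principal {w : Fin d → H} (hw : IsPrincipalVectors V W w)
    (i j : Fin d) : inner ℂ (V.starProjection (w i)) (V.starProjection (w j))
      = ((Real.cos (principalAngle V W j) ^ 2 : ℝ) : ℂ) * inner ℂ (w i) (w j) := by
  have hiW : w i ∈ W := hw.2.1 ▸ Submodule.subset_span ⟨i, rfl⟩
  rw [inner_starProjection_right_of_mem (V.starProjection_apply_mem (w i)),
    V.inner_starProjection_left_eq_right, ← inner_starProjection_right_of_mem hiW,
    starProjection_starProjection_principal hw, inner_smul_right]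

/-- Nonnegativity comes from `|P_V P_W| ≥ 0`. A zero cosine would make `P_V (w j) = 0`, which
complementarity excludes. -/
theorem cos_principalAngle_pos (hVW : IsCompl V Wᗮ) {w : Fin d → H}
    (hw : IsPrincipalVectors V W w) (j : Fin d) : 0 < Real.cos (principalAngle V W j) := by
  have hjW : w j ∈ W := hw.2.1 ▸ Submodule.subset_span ⟨j, rfl⟩
  have h0 : 0 ≤ Real.cos (principalAngle V W j) := by
    have h1 := ((ContinuousLinearMap.nonneg_iff_isPositive _).1
      (CFC.abs_nonneg (V.starProjection * W.starProjection))).re_inner_nonneg_left (w j)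
    rw [hw.2.2 j, inner_smul_left, Complex.conj_ofReal, inner_self_eq_norm_sq_to_K,
      hw.1.1 j] at h1
    simpa [-Complex.ofReal_cos] using h1
  refine lt_of_le_of_ne h0 fun h => ?_
  have h1 := inner_starProjection_principal hw j j
  rw [← h] at h1
  have h2 : V.starProjection (w j) = 0 := by
    rw [← inner_self_eq_zero (𝕜 := ℂ), h1]
    simp
  exact hw.1.ne_zero j (eq_zero_of_mem_of_starProjection_eq_zero hVW hjW h2)

variable (hVW : IsCompl V Wᗮ) {E : Fin n → H} {w : Fin d → H} (hw : IsPrincipalVectors V W w)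

-- The left side is `‖P_V x‖²`, whatever the basis `u`; it is diagonal in the principal vectors of
-- `W`.
include hw in
theorem sum_norm_sq_inner_eq_principal (b : OrthonormalBasis (Fin d) ℂ W)
    (hb : ∀ j, (b j : H) = w j) (u : OrthonormalBasis (Fin d) ℂ V) (x : W) :
    ∑ i, ‖inner ℂ (u i : H) (x : H)‖ ^ 2
      = ∑ j : Fin d, Real.cos (principalAngle V W j) ^ 2 * ‖inner ℂ (b j) x‖ ^ 2 := by
  have h1 : ∀ i, inner ℂ (u i : H) (x : H) = inner ℂ (u i) (V.orthogonalProjectionOnto (x : H)) :=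
    fun i => (inner_starProjection_right_of_mem (u i).2 (x : H)).symm
  simp_rw [h1]
  rw [u.sum_sq_norm_inner_right]
  have h2 : ((‖V.orthogonalProjectionOnto (x : H)‖ ^ 2 : ℝ) : ℂ)
      = inner ℂ (V.starProjection (x : H)) (V.starProjection (x : H)) := by
    rw [inner_self_eq_norm_sq_to_K]; norm_cast
  have hx : (x : H) = ∑ j, inner ℂ (b j) x • w j := by
    have := congrArg (Submodule.subtype W) (b.sum_repr' x)
    simpa [hb] using this.symm
  conv_rhs at h2 => rw [hx, map_sum, sum_inner]
  simp_rw [inner_sum, map_smul, inner_smul_left, inner_smul_right,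
    inner_starProjection_principal hw, orthonormal_iff_ite.1 hw.1] at h2
  simp only [mul_ite, mul_one, mul_zero, sum_ite_eq, mem_univ, if_true] at h2
  have h3 : ∀ j : Fin d, (starRingEnd ℂ) (inner ℂ (b j) x)
      * (inner ℂ (b j) x * ((Real.cos (principalAngle V W j) ^ 2 : ℝ) : ℂ))
      = ((Real.cos (principalAngle V W j) ^ 2 * ‖inner ℂ (b j) x‖ ^ 2 : ℝ) : ℂ) := fun j => by
    rw [← mul_assoc, Complex.conj_mul']
    push_cast
    ring
  simp_rw [h3] at h2
  exact_mod_cast h2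

/-- The frame operator of the canonical dual is diagonalized by the principal vectors of `V` when
that of the frame is diagonalized by the principal vectors of `W`. -/
theorem exists_basis_canonicalDual_principal (hE : spanOf E = W)
    (hw : IsPrincipalVectors V W w) {l : Fin d → ℝ} (hl : ∀ j, 0 < l j)
    (hwE : ∀ j, frameOp E (w j) = (l j : ℂ) • w j) :
    ∃ u : OrthonormalBasis (Fin d) ℂ V, ∀ x : V,
      ∑ i, ‖inner ℂ (canonicalDual V W hVW E i) (x : H)‖ ^ 2
        = ∑ j : Fin d, ((l j)⁻¹ / Real.cos (principalAngle V W j) ^ 2)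
          * ‖inner ℂ (u j) x‖ ^ 2 := by
  set γ : Fin d → ℝ := fun j => Real.cos (principalAngle V W j) with hγ
  have hγ0 : ∀ j, 0 < γ j := cos_principalAngle_pos hVW hw
  obtain ⟨b, hb⟩ := exists_orthonormalBasis_of_span_eq hw.1 hw.2.1
  -- The principal vectors of `V`: the `P_V (w j)` are orthogonal with norms `γ j`.
  let v : Fin d → V := fun j => (((γ j)⁻¹ : ℝ) : ℂ) • V.orthogonalProjectionOnto (w j)
  have hvo : Orthonormal ℂ v := by
    rw [orthonormal_iff_ite]
    intro i j
    have h1 : inner ℂ (V.orthogonalProjectionOnto (w i)) (V.orthogonalProjectionOnto (w j))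
        = ((γ j ^ 2 : ℝ) : ℂ) * inner ℂ (w i) (w j) := inner_starProjection_principal hw i j
    simp only [v, inner_smul_left, inner_smul_right, h1, Complex.conj_ofReal,
      orthonormal_iff_ite.1 hw.1]
    split_ifs with hij
    · subst hij
      have : (γ i : ℂ) ≠ 0 := by exact_mod_cast (hγ0 i).ne'
      push_cast
      field_simp
    · simp
  have hfin : Module.finrank ℂ V = d := by
    rw [finrank_eq_of_isCompl_orthogonal hVW]
    simpa using Module.finrank_eq_card_basis b.toBasis
  have htop : Submodule.span ℂ (Set.range v) = ⊤ :=
    hvo.linearIndependent.span_eq_top_of_card_eq_finrank' (by simp [hfin])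
  let u := OrthonormalBasis.mk hvo htop.ge
  have hu : ∀ j, u j = v j := fun j => by simp [u]
  refine ⟨u, fun x => ?_⟩
  -- The preimage of `x` in `W` under `P_V`. The dual lies in `V`, so it pairs equally with both,
  -- and its form on `W` is known.
  let x' : W := ∑ j, (inner ℂ (u j) x * ((γ j)⁻¹ : ℝ) : ℂ) • b j
  have hx' : V.starProjection (x' : H) = x := by
    have h1 := congrArg (Submodule.subtype V) (u.sum_repr' x)
    rw [Submodule.subtype_apply, Submodule.subtype_apply] at h1
    rw [← h1]
    simp only [x', AddSubmonoidClass.coe_finsetSum, Submodule.coe_smul, map_sum, map_smul, hb, hu,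
      v, smul_smul]
    rfl
  have h1 : ∀ i, inner ℂ (canonicalDual V W hVW E i) (x : H)
      = inner ℂ (canonicalDual V W hVW E i) (x' : H) := fun i => by
    rw [← hx']
    exact inner_starProjection_right_of_mem (Submodule.projection_apply_mem hVW _) _
  simp_rw [h1]
  rw [sum_norm_sq_canonicalDual hVW hE b hl (fun j => by rw [hb]; exact hwE j)]
  refine sum_congr rfl fun j _ => ?_
  have h2 : inner ℂ (b j) x' = inner ℂ (u j) x * ((γ j)⁻¹ : ℝ) := b.orthonormal.inner_right_fintype _ j
  rw [h2, norm_mul, mul_pow, Complex.norm_real, Real.norm_eq_abs, sq_abs]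
  change _ = (l j)⁻¹ / γ j ^ 2 * _
  field_simp

/-- Multiplicative Lidskii inequality for the eigenvalues of the canonical dual. -/
theorem prod_le_prod_cos_mul_prod_frameEig (hE : spanOf E = W) (y : OrthonormalBasis (Fin d) ℂ W)
    {l : Fin d → ℝ} (hl : ∀ j, 0 < l j) (hla : Antitone l)
    (hy : ∀ j, frameOp E (y j) = (l j : ℂ) • (y j : H)) (hw : IsPrincipalVectors V W w)
    (J : Finset (Fin d)) :
    ∏ j ∈ J, (l (Fin.rev j))⁻¹ ≤ (∏ j ∈ J, Real.cos (principalAngle V W j) ^ 2)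
      * ∏ i ∈ range J.card, frameEig (canonicalDual V W hVW E) i := by
  have hW : Module.finrank ℂ W = d := by simpa using Module.finrank_eq_card_basis y.toBasis
  have hV : Module.finrank ℂ V = d := (finrank_eq_of_isCompl_orthogonal hVW).trans hW
  have hspan := spanOf_canonicalDual hVW hE
  obtain ⟨b, hb⟩ := exists_orthonormalBasis_of_span_eq hw.1 hw.2.1
  obtain ⟨u, hu⟩ := exists_basis_frameEig hspan hV
  have hγ0 := cos_principalAngle_pos hVW hw
  have hp : ∀ i (x : W), inner ℂ (W.orthogonalProjectionOnto (u i : H)) x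
      = inner ℂ (u i : H) (x : H) := fun i x => by
    have h1 := W.inner_starProjection_left_eq_right (u i : H) (x : H)
    rwa [Submodule.starProjection_eq_self_iff.mpr x.2] at h1
  -- With `p i = P_W (u i)`, the weights `frameEig` give the form with eigenvalues `l⁻¹` and unit
  -- weights give `cos²`. Reversing `y` puts `l⁻¹` in non-increasing order.
  refine prod_le_prod_mul_prod hW (p := fun i => W.orthogonalProjectionOnto (u i : H))
    (frameEig_le_frameEig (by rw [hspan, hV])) (frameEig_pos hspan hV) (y.reindex Fin.revPerm) b
    (fun i j hij => ?_) (fun i j hij => ?_) (fun j => inv_pos.2 (hl _))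
    (fun j => pow_pos (hγ0 j) 2) (fun x => ?_) (fun x => ?_) J
  · exact inv_anti₀ (hl _) (hla (Fin.rev_le_rev.2 hij))
  · exact pow_le_pow_left₀ (hγ0 j).le (cos_principalAngle_antitone hV hij) 2
  · have h1 := hu (V.orthogonalProjectionOnto (x : H))
    have h2 : ∀ i, inner ℂ (canonicalDual V W hVW E i) (V.orthogonalProjectionOnto (x : H) : H)
        = inner ℂ (canonicalDual V W hVW E i) (x : H) := fun i =>
      inner_starProjection_right_of_mem (Submodule.projection_apply_mem _ _) (x : H)
    have h3 : ∀ i, inner ℂ (u i) (V.orthogonalProjectionOnto (x : H)) = inner ℂ (u i : H) (x : H) :=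
      fun i => inner_starProjection_right_of_mem (u i).2 (x : H)
    simp_rw [h2, h3] at h1
    rw [sum_norm_sq_canonicalDual hVW hE y hl hy, ← Equiv.sum_comp Fin.revPerm] at h1
    simp_rw [hp, ← h1]
    simp
  · simp_rw [hp]
    exact sum_norm_sq_inner_eq_principal hw b hb u x

/-- Aligning the eigenvectors of the frame operator with the principal vectors, in opposite order,
minimizes the spectrum of the canonical dual in submajorization. -/
theorem partialSums_frameEig_canonicalDual_le {E₀ : Fin n → H} (hE : spanOf E = W)
    (hE₀ : spanOf E₀ = W) (y : OrthonormalBasis (Fin d) ℂ W)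
    {l : Fin d → ℝ} (hl : ∀ j, 0 < l j) (hla : Antitone l)
    (hy : ∀ j, frameOp E (y j) = (l j : ℂ) • (y j : H)) (hw : IsPrincipalVectors V W w)
    (hwE : ∀ j, frameOp E₀ (w j) = (l (Fin.rev j) : ℂ) • w j) {k : ℕ} (hk : k ≤ d) :
    ∑ i ∈ range k, frameEig (canonicalDual V W hVW E₀) i
      ≤ ∑ i ∈ range k, frameEig (canonicalDual V W hVW E) i := by
  have hW : Module.finrank ℂ W = d := by simpa using Module.finrank_eq_card_basis y.toBasis
  have hV : Module.finrank ℂ V = d := (finrank_eq_of_isCompl_orthogonal hVW).trans hW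
  have hspan := spanOf_canonicalDual hVW hE
  have hspan₀ := spanOf_canonicalDual hVW hE₀
  have hγ0 := cos_principalAngle_pos hVW hw
  obtain ⟨u, hu⟩ := exists_basis_canonicalDual_principal hVW hE₀ hw (fun j => hl (Fin.rev j)) hwE
  obtain ⟨σ, hσ⟩ := exists_perm_frameEig_eq hspan₀ u hu
  refine sum_le_sum_of_prod_le_prod
    (fun i j hij hj => frameEig_le_frameEig (by rw [hspan₀, hV]) i j hij (hj.trans_le hk))
    (fun i hi => frameEig_pos hspan₀ hV i (hi.trans_le hk))
    (fun i hi => frameEig_pos hspan hV i (hi.trans_le hk)) fun j hj => ?_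
  have hjd := hj.trans hk
  -- The `j` largest quotients sit at the indices `σ 0, …, σ (j - 1)`, so the product inequality is
  -- needed for arbitrary index sets.
  let f : Fin j ↪ Fin d := (Fin.castLEEmb hjd).trans σ.toEmbedding
  have h1 := prod_le_prod_cos_mul_prod_frameEig hVW hE y hl hla hy hw (univ.map f)
  rw [card_map, card_univ, Fintype.card_fin] at h1
  have h2 : ∏ i ∈ range j, frameEig (canonicalDual V W hVW E₀) i
      = ∏ i ∈ univ.map f, (l (Fin.rev i))⁻¹ / Real.cos (principalAngle V W i) ^ 2 := by
    rw [prod_map, ← Fin.prod_univ_eq_prod_range]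
    exact prod_congr rfl fun i _ => hσ (Fin.castLE hjd i)
  rw [h2, prod_div_distrib, div_le_iff₀ (prod_pos fun i _ => pow_pos (hγ0 i) 2), mul_comm]
  exact h1

end Principal

/-! ### Optimal duals under a trace restriction. -/

section Optimal

variable {H : Type*} [NormedAddCommGroup H] [InnerProductSpace ℂ H] [CompleteSpace H] {n d : ℕ}
  {V W : Submodule ℂ H}
  (hVW : IsCompl V Wᗮ) {E : Fin n → H}

section Eigenbasis

variable (hE : spanOf E = W) (y : OrthonormalBasis (Fin d) ℂ W) {l : Fin d → ℝ}
  (hl : ∀ j, 0 < l j) (hy : ∀ j, frameOp E (y j) = (l j : ℂ) • (y j : H))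

include hE hl hy

theorem frameEig_canonicalDual_le (hV : Module.finrank ℂ V = d) {G : Fin n → H}
    (hG : G ∈ obliqueDuals V E) {k : ℕ} (hk : k < d) :
    frameEig (canonicalDual V W hVW E) k ≤ frameEig G k := by
  have hs := spanOf_canonicalDual hVW hE
  have hsG := spanOf_eq_of_mem_obliqueDuals hG
  obtain ⟨u, hu⟩ := exists_basis_frameEig hs hV
  obtain ⟨v, hv⟩ := exists_basis_frameEig hsG hV
  exact le_of_form_le u v (frameEig_antitone (by rw [hs, hV])) (frameEig_antitone (by rw [hsG, hV]))
    (fun x => by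
      rw [← hu, ← hv]
      exact sum_norm_sq_canonicalDual_le hVW hE y hl hy hG x) ⟨k, hk⟩

/-- A dual whose spectrum is obtained from that of the canonical dual by filling up from below. -/
theorem exists_obliqueDual_frameEig_eq_max (hd : 0 < d) (hV : Module.finrank ℂ V = d)
    (hn : 2 * d ≤ n) {t : ℝ}
    (ht : ∑ k ∈ range d, frameEig (canonicalDual V W hVW E) k ≤ t) :
    ∃ G ∈ obliqueDualsTr V E t, ∃ c, ∑ k ∈ range d, frameEig G k = t ∧
      ∀ k < d, frameEig G k = max (frameEig (canonicalDual V W hVW E) k) c := by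
  have hs := spanOf_canonicalDual hVW hE
  obtain ⟨u, hu⟩ := exists_basis_frameEig hs hV
  obtain ⟨c, hc⟩ := exists_sum_max_eq hd (frameEig_pos hs hV) ht
  have ha := frameEig_antitone (G := canonicalDual V W hVW E) (d := d) (by rw [hs, hV])
  obtain ⟨G, hG, hGu⟩ := exists_obliqueDual_form_eq hVW hE y hl hy hn u
    (b := fun k => max (frameEig (canonicalDual V W hVW E) k) c) (fun k => le_max_left _ _) hu
  have hsG := spanOf_eq_of_mem_obliqueDuals hG
  have heig : ∀ k < d, frameEig G k = max (frameEig (canonicalDual V W hVW E) k) c :=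
    fun k hk => frameEig_eq_of_form hsG u (fun i j hij => max_le_max (ha hij) le_rfl) hGu ⟨k, hk⟩
  have hsum : ∑ k ∈ range d, frameEig G k = t :=
    (sum_congr rfl fun k hk => heig k (mem_range.1 hk)).trans hc
  exact ⟨G, ⟨hG, by rw [← sum_frameEig_eq_sum_norm_sq hsG hV, hsum]⟩, c, hsum, heig⟩

/-- The spectrum of `G` dominates that of the canonical dual of `E`, so it submajorizes that of
`E₀`; its trace is at least `t`, so filling up to total `t` preserves this. The case `E₀ = E` gives
existence of optimal duals, the general case the comparison of two frames. -/
theorem convexPotential_le_of_partialSums_le {E₀ G₀ G : Fin n → H} (hE₀ : spanOf E₀ = W)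
    (hV : Module.finrank ℂ V = d)
    (hle : ∀ k ≤ d, ∑ i ∈ range k, frameEig (canonicalDual V W hVW E₀) i
      ≤ ∑ i ∈ range k, frameEig (canonicalDual V W hVW E) i)
    {t c : ℝ} (hG₀ : G₀ ∈ obliqueDuals V E₀) (hsum : ∑ k ∈ range d, frameEig G₀ k = t)
    (heig : ∀ k < d, frameEig G₀ k = max (frameEig (canonicalDual V W hVW E₀) k) c)
    (hG : G ∈ obliqueDualsTr V E t) {h : ℝ → ℝ} (hh : IsConv h)
    (hm : MonotoneOn h (Set.Ici 0)) : convexPotential h G₀ ≤ convexPotential h G := by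
  have hs₀ := spanOf_canonicalDual hVW hE₀
  have hsG := spanOf_eq_of_mem_obliqueDuals hG.1
  have hsG₀ := spanOf_eq_of_mem_obliqueDuals hG₀
  rw [convexPotential_eq hsG hV, convexPotential_eq hsG₀ hV]
  refine sum_convex_le_sum_of_partialSums_le hh.1 hm (frameEig_le_frameEig (by rw [hsG₀, hV]))
    (frameEig_pos hsG₀ hV) (fun i hi => (frameEig_pos hsG hV i hi).le) fun j hj => ?_
  rw [sum_congr rfl fun i hi => heig i ((mem_range.1 hi).trans_le hj)]
  refine partialSums_max_le (frameEig_le_frameEig (by rw [hsG, hV]))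
    (frameEig_le_frameEig (by rw [hs₀, hV])) (fun k hk => (hle k hk).trans ?_) ?_ j hj
  · exact sum_le_sum fun i hi =>
      frameEig_canonicalDual_le hVW hE y hl hy hV hG.1 ((mem_range.1 hi).trans_le hk)
  · rw [← sum_congr rfl fun i hi => heig i (mem_range.1 hi), hsum,
      sum_frameEig_eq_sum_norm_sq hsG hV]
    exact hG.2

theorem exists_isOptimalDual (hd : 0 < d) (hV : Module.finrank ℂ V = d) (hn : 2 * d ≤ n) {t : ℝ}
    (ht : frameTrace (canonicalDual V W hVW E) ≤ t) :
    ∃ G c, IsOptimalDual V E t G ∧ ∑ k ∈ range d, frameEig G k = t ∧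
      ∀ k < d, frameEig G k = max (frameEig (canonicalDual V W hVW E) k) c := by
  rw [frameTrace_eq (spanOf_canonicalDual hVW hE) hV] at ht
  obtain ⟨G, hG, c, hsum, heig⟩ := exists_obliqueDual_frameEig_eq_max hVW hE y hl hy hd hV hn ht
  exact ⟨G, c, ⟨hG, fun h hh hm G' hG' => convexPotential_le_of_partialSums_le hVW hE y hl hy hE hV
    (fun _ _ => le_rfl) hG.1 hsum heig hG' hh hm⟩, hsum, heig⟩

end Eigenbasis

theorem isConv_id : IsConv fun x => x :=
  ⟨convexOn_id (convex_Ici 0), fun _ hx => hx⟩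

/-- Minimality for `h = id` bounds the trace by that of `G'`, namely `t`; the restriction gives the
reverse bound. -/
theorem sum_frameEig_eq_of_isOptimalDual (hV : Module.finrank ℂ V = d) {t : ℝ} {G G' : Fin n → H}
    (hG : IsOptimalDual V E t G) (hG' : G' ∈ obliqueDualsTr V E t)
    (hsum : ∑ k ∈ range d, frameEig G' k = t) : ∑ k ∈ range d, frameEig G k = t := by
  have hs := spanOf_eq_of_mem_obliqueDuals hG.1.1
  have h1 := hG.2 _ isConv_id (fun _ _ _ _ h => h) G' hG'
  rw [convexPotential_eq hs hV, convexPotential_eq (spanOf_eq_of_mem_obliqueDuals hG'.1) hV,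
    hsum] at h1
  refine le_antisymm h1 ?_
  rw [sum_frameEig_eq_sum_norm_sq hs hV]
  exact hG.1.2

/-- For families spanning the same space with equal traces, it suffices to compare non-decreasing
convex potentials. -/
theorem convexPotential_le_of_monotone {G₀ G : Fin n → H} (hV : Module.finrank ℂ V = d)
    (hd : 0 < d) (hs₀ : spanOf G₀ = V) (hs : spanOf G = V)
    (hsum : ∑ k ∈ range d, frameEig G₀ k = ∑ k ∈ range d, frameEig G k)
    (hmono : ∀ h : ℝ → ℝ, IsConv h → MonotoneOn h (Set.Ici 0) →
      convexPotential h G₀ ≤ convexPotential h G) {h : ℝ → ℝ} (hh : IsConv h) :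
    convexPotential h G₀ ≤ convexPotential h G := by
  set m := min (frameEig G₀ (d - 1)) (frameEig G (d - 1))
  have hm : 0 < m := lt_min (frameEig_pos hs₀ hV _ (by omega)) (frameEig_pos hs hV _ (by omega))
  obtain ⟨g, s, c, hg, hgm, hgh⟩ := exists_monotone_isConv hh hm
  have hm₀ : ∀ k ∈ range d, m ≤ frameEig G₀ k := fun k hk => (min_le_left _ _).trans
    (frameEig_le_frameEig (by rw [hs₀, hV]) _ _ (Nat.le_sub_one_of_lt (mem_range.1 hk)) (by omega))
  have hm₁ : ∀ k ∈ range d, m ≤ frameEig G k := fun k hk => (min_le_right _ _).trans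
    (frameEig_le_frameEig (by rw [hs, hV]) _ _ (Nat.le_sub_one_of_lt (mem_range.1 hk)) (by omega))
  have h1 := hmono g hg hgm
  rw [convexPotential_eq hs₀ hV, convexPotential_eq hs hV,
    sum_congr rfl fun k hk => hgh _ (hm₀ k hk), sum_congr rfl fun k hk => hgh _ (hm₁ k hk)] at h1
  -- The affine corrections agree on both sides because the traces and the numbers of eigenvalues
  -- do.
  simp only [sum_sub_distrib, ← mul_sum, hsum] at h1
  rw [convexPotential_eq hs₀ hV, convexPotential_eq hs hV]
  linarith

end Optimal

end ObliqueDual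

end

/-! ### The main theorem. -/

theorem theorem4p7 {H : Type*} [NormedAddCommGroup H] [InnerProductSpace ℂ H] [CompleteSpace H]
    (V W : Submodule ℂ H) [FiniteDimensional ℂ V] [FiniteDimensional ℂ W]
    (hVW : IsCompl V Wᗮ) (d n : ℕ) (hd : Module.finrank ℂ W = d) (hn : 2 * d ≤ n)
    (F : Fin n → H) (hF : ObliqueDual.IsFrameFor W F)
    (w : Fin d → H) (hw : ObliqueDual.IsPrincipalVectors V W w)
    (x : Fin d → H) (hx : Orthonormal ℂ x) (hxW : Submodule.span ℂ (Set.range x) = W)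
    (hxS : ∀ j : Fin d, ObliqueDual.frameOp F (x j)
      = ((ObliqueDual.frameEig F j : ℝ) : ℂ) • x j)
    (U₀ : H ≃ₗᵢ[ℂ] H) (hU₀ : ∀ j : Fin d, U₀ (x j) = w (Fin.rev j)) :
    (∀ U : H ≃ₗᵢ[ℂ] H, W.map U.toLinearEquiv.toLinearMap = W →
      ObliqueDual.frameTrace
          (ObliqueDual.canonicalDual V W hVW (ObliqueDual.rotate U₀ F))
        ≤ ObliqueDual.frameTrace
          (ObliqueDual.canonicalDual V W hVW (ObliqueDual.rotate U F))) ∧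
    (∀ U : H ≃ₗᵢ[ℂ] H, W.map U.toLinearEquiv.toLinearMap = W → ∀ t : ℝ,
      ObliqueDual.frameTrace
          (ObliqueDual.canonicalDual V W hVW (ObliqueDual.rotate U F)) ≤ t →
      (0 < d → (∃ G₀, ObliqueDual.IsOptimalDual V (ObliqueDual.rotate U₀ F) t G₀) ∧
        ∃ G, ObliqueDual.IsOptimalDual V (ObliqueDual.rotate U F) t G) ∧
      ∀ G₀ G : Fin n → H,
        ObliqueDual.IsOptimalDual V (ObliqueDual.rotate U₀ F) t G₀ →
        ObliqueDual.IsOptimalDual V (ObliqueDual.rotate U F) t G →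
        ∀ h : ℝ → ℝ, ObliqueDual.IsConv h →
          ObliqueDual.convexPotential h G₀ ≤ ObliqueDual.convexPotential h G) := by
  open ObliqueDual in
  have hV : Module.finrank ℂ V = d := (finrank_eq_of_isCompl_orthogonal hVW).trans hd
  have hspanF : spanOf F = W := spanOf_eq_of_isFrameFor hF
  set l : Fin d → ℝ := fun j => frameEig F j
  have hl : ∀ j, 0 < l j := fun j => frameEig_pos hspanF hd j j.2
  have hla : Antitone l := frameEig_antitone (by rw [hspanF, hd])
  have hrot : ∀ U : H ≃ₗᵢ[ℂ] H, ∀ j, frameOp (rotate U F) (U (x j)) = (l j : ℂ) • U (x j) :=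
    fun U j => by rw [frameOp_rotate_apply, hxS, map_smul]
  have hU₀W : W.map U₀.toLinearEquiv.toLinearMap = W := by
    conv_lhs => rw [← hxW, Submodule.map_span, ← Set.range_comp]
    rw [← hw.2.1, ← Fin.rev_surjective.range_comp w]
    congr 2
    exact funext hU₀
  have hspan : ∀ U : H ≃ₗᵢ[ℂ] H, W.map U.toLinearEquiv.toLinearMap = W →
      spanOf (rotate U F) = W := fun U hU => by rw [spanOf_rotate, hspanF, hU]
  have hbasis : ∀ U : H ≃ₗᵢ[ℂ] H, W.map U.toLinearEquiv.toLinearMap = W →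
      ∃ y : OrthonormalBasis (Fin d) ℂ W,
        ∀ j, frameOp (rotate U F) (y j) = (l j : ℂ) • (y j : H) := fun U hU => by
    obtain ⟨y, hy⟩ := exists_orthonormalBasis_of_span_eq (W := W)
      (hx.comp_linearIsometry U.toLinearIsometry) (by
        conv_rhs => rw [← hU, ← hxW, Submodule.map_span, ← Set.range_comp]
        rfl)
    refine ⟨y, fun j => ?_⟩
    rw [hy]
    exact hrot U j
  have hE₀ := hspan U₀ hU₀W
  have hwE : ∀ j, frameOp (rotate U₀ F) (w j) = (l (Fin.rev j) : ℂ) • w j := fun j => by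
    have h1 := hrot U₀ (Fin.rev j)
    rwa [hU₀, Fin.rev_rev] at h1
  have hle : ∀ U : H ≃ₗᵢ[ℂ] H, W.map U.toLinearEquiv.toLinearMap = W → ∀ k ≤ d,
      ∑ i ∈ Finset.range k, frameEig (canonicalDual V W hVW (rotate U₀ F)) i
        ≤ ∑ i ∈ Finset.range k, frameEig (canonicalDual V W hVW (rotate U F)) i :=
    fun U hU k hk => by
      obtain ⟨y, hy⟩ := hbasis U hU
      exact partialSums_frameEig_canonicalDual_le hVW (hspan U hU) hE₀ y hl hla hy hw hwE hk
  have htr : ∀ U : H ≃ₗᵢ[ℂ] H, W.map U.toLinearEquiv.toLinearMap = W →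
      frameTrace (canonicalDual V W hVW (rotate U₀ F))
        ≤ frameTrace (canonicalDual V W hVW (rotate U F)) := fun U hU => by
    rw [frameTrace_eq (spanOf_canonicalDual hVW hE₀) hV,
      frameTrace_eq (spanOf_canonicalDual hVW (hspan U hU)) hV]
    exact hle U hU d le_rfl
  refine ⟨htr, fun U hU t ht => ?_⟩
  obtain ⟨y₀, hy₀⟩ := hbasis U₀ hU₀W
  obtain ⟨y, hy⟩ := hbasis U hU
  have hE := hspan U hU
  refine ⟨fun hd0 => ?_, fun G₀ G hG₀ hG h hh => ?_⟩
  · obtain ⟨G₀, -, hG₀, -⟩ :=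
      exists_isOptimalDual hVW hE₀ y₀ hl hy₀ hd0 hV hn ((htr U hU).trans ht)
    obtain ⟨G, -, hG, -⟩ := exists_isOptimalDual hVW hE y hl hy hd0 hV hn ht
    exact ⟨⟨G₀, hG₀⟩, G, hG⟩
  · have hs₀ := spanOf_eq_of_mem_obliqueDuals hG₀.1.1
    have hs := spanOf_eq_of_mem_obliqueDuals hG.1.1
    rcases Nat.eq_zero_or_pos d with rfl | hd0
    · rw [convexPotential_eq hs₀ hV, convexPotential_eq hs hV]
      simp
    obtain ⟨G₁, c, hG₁, hsum₁, heig₁⟩ :=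
      exists_isOptimalDual hVW hE₀ y₀ hl hy₀ hd0 hV hn ((htr U hU).trans ht)
    obtain ⟨G₂, -, hG₂, hsum₂, -⟩ := exists_isOptimalDual hVW hE y hl hy hd0 hV hn ht
    have ht₀ := sum_frameEig_eq_of_isOptimalDual hV hG₀ hG₁.1 hsum₁
    have ht₁ := sum_frameEig_eq_of_isOptimalDual hV hG hG₂.1 hsum₂
    -- For non-decreasing `g` the filled-up dual `G₁` mediates: optimality of `G₀` bounds it by
    -- `G₁`, and submajorization bounds `G₁` by `G`.
    exact convexPotential_le_of_monotone hV hd0 hs₀ hs (ht₀.trans ht₁.symm)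
      (fun g hg hgm => (hG₀.2 g hg hgm G₁ hG₁.1).trans
        (convexPotential_le_of_partialSums_le hVW hE y hl hy hE₀ hV (hle U hU) hG₁.1.1 hsum₁ heig₁
          hG.1 hg hgm)) hh
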